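/- Let $X$ be a simple graph, possibly infinite, that is $(q+1)$-regular for some integer $q\ge 0$. A path of length $m$ is a sequence of oriented edges $C=(e_1,\dots,e_m)$ in which each $e_{i+1}$ starts where $e_i$ ends (a vertex is a path of length $0$); its bump count $\mathrm{bc}(C)$ is the number of $i\in\{1,\dots,m-1\}$ such that $e_i$ is the reverse of $e_{i+1}$. Let $A_X$ be the adjacency operator, $D_X=(q+1)I$ the valency operator and $\Delta_X=D_X-A_X$ the Laplacian on $\ell^2(VX)$. For an operator $B$ put $B(x_0,x)=(B\delta_{x_0})(x)$. For $t\in\mathbb C$ and $m\ge 0$ let $$(C_m(t)f)(x)=\sum_{C}t^{\mathrm{bc}(C)}f(\text{end point of }C),$$ the sum being over all paths $C$ of length $m$ starting at $x$. Put $Q_X(t)=D_X-(1-t)I$ and $c_k(y)=C_k(t)(y,y)$, and let $R_m(t)$ be the operator of multiplication by the function $$x\mapsto\sum_{j=1}^{\lceil m/2\rceil-1}\sum_{i=1}^{j}(1-t)^{2(j-i)}(1-t^2)^{i-1}(\Delta_Xc_{m-2j})(x),\qquad (\Delta_Xc)(x)=(q+1)c(x)-\sum_{y\sim x}c(y).$$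 Let $C^{\mathrm{cbc}}_1(t)=C_1(t)$, $C^{\mathrm{cbc}}_2(t)=t\,C_2(t)$ and, for $m\ge 3$, $$C^{\mathrm{cbc}}_m(t)=C_m(t)-\frac{Q_X(t)-(1-t)I}{1-t}\sum_{j=1}^{\lceil m/2\rceil-1}(1-t)^{2j}C_{m-2j}(t)+(1-t)R_m(t)-\varepsilon_m(1-t)^{m-1}t\,D_X,$$ where $\varepsilon_m=1$ if $m$ is even and $\varepsilon_m=0$ if $m$ is odd. Define $$Z_X(u,t,x_0,x)=\exp\Big(\sum_{m=1}^\infty\frac{C^{\mathrm{cbc}}_m(t)(x_0,x)}{m}u^m\Big),\qquad \alpha(t)=\frac{M+\sqrt{M^2+4(|t|+1)M}}{2},\quad M=q+1.$$ Let $E$ be the spectral measure of the bounded self-adjoint operator $\Delta_X$, so that $\Delta_X=\int_{\sigma(\Delta_X)}\lambda\,dE(\lambda)$, and let $\mu_{x_0,x}$ be the complex measure $d\mu_{x_0,x}(\lambda)=d\langle E(\lambda)\delta_{x_0},\delta_x\rangle$ on $\sigma(\Delta_X)$. Then for all $t,u\in\mathbb C$ with $|t|<1$ and $|u|<1/\alpha(t)$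 and all vertices $x_0,x$, the two series and the integral below (the series being those in the definition of $Z_X$ and in the last factor) converge absolutely, and, with principal branches of the logarithm and the power, $$\begin{aligned}Z_X(u,t,x_0,x)={}&\big(1-(1-t)^2u^2\big)^{-\frac{q-1}{2}\delta_{x_0}(x)}\\&\times\exp\Big(\int_{\sigma(\Delta_X)}-\log\big(1-(q+1-\lambda)u+(1-t)(q+t)u^2\big)\,d\mu_{x_0,x}(\lambda)\Big)\\&\times\exp\Big(\frac{[tD_X-C_2(t)](x_0,x)}{2}(1-t)u^2\Big)\\&\times\exp\Big(\sum_{m=3}^\infty\frac{(1-t)R_m(t)(x_0,x)}{m}u^m\Big).\end{aligned}$$ -/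

import Mathlib

set_option linter.unusedSectionVars false

namespace Bartholdi

open MeasureTheory Filter Topology
open scoped InnerProductSpace

section Spectral
universe u₁ u₂

/-- A projection-valued measure (resolution of the identity) on a measurable space `α`, acting on
the complex Hilbert space `H`: measurable sets go to orthogonal projections, `E ∅ = 0`, `E α = 1`,
`E (A ∩ B) = E A * E B`, and `B ↦ ⟨E B v, w⟩` is countably additive for all `v`, `w`. The values on
non-measurable sets play no role. (Mathlib's inner product is linear in the second variable, so
the `⟨E B v, w⟩` that is linear in `v` is `⟪w, E B v⟫_ℂ`.) -/
structure ProjectionValuedMeasure (α : Type u₁) [MeasurableSpace α]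
    (H : Type u₂) [NormedAddCommGroup H] [InnerProductSpace ℂ H] [CompleteSpace H] where
  proj : Set α → H →L[ℂ] H
  isStarProjection : ∀ B, MeasurableSet B → IsStarProjection (proj B)
  proj_empty : proj ∅ = 0
  proj_univ : proj Set.univ = 1
  proj_inter : ∀ A B, MeasurableSet A → MeasurableSet B → proj (A ∩ B) = proj A * proj B
  hasSum_inner : ∀ (B : ℕ → Set α), (∀ n, MeasurableSet (B n)) →
    Pairwise (fun i j => Disjoint (B i) (B j)) → ∀ v w : H,
    HasSum (fun n => ⟪w, proj (B n) v⟫_ℂ) ⟪w, proj (⋃ n, B n) v⟫_ℂ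

variable {X : Type u₁} [MeasurableSpace X]
  {H : Type u₂} [NormedAddCommGroup H] [InnerProductSpace ℂ H] [CompleteSpace H]

open Classical in
/-- The complex measure `B ↦ ⟨E B v, w⟩`. -/
noncomputable def ProjectionValuedMeasure.complexMeasure (E : ProjectionValuedMeasure X H)
    (v w : H) : ComplexMeasure X where
  measureOf' B := if MeasurableSet B then ⟪w, E.proj B v⟫_ℂ else 0
  empty' := by simp [E.proj_empty]
  not_measurable' B hB := by simp [hB]
  m_iUnion' B hB hd := by
    simpa [hB, MeasurableSet.iUnion hB] using E.hasSum_inner B hB hd v w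

theorem ProjectionValuedMeasure.complexMeasure_apply (E : ProjectionValuedMeasure X H)
    (v w : H) {B : Set X} (hB : MeasurableSet B) :
    E.complexMeasure v w B = ⟪w, E.proj B v⟫_ℂ := if_pos hB

/-- A complex measure dominated by a finite positive measure. -/
theorem integrable_of_le {ν : ComplexMeasure X} {p : Measure X} [IsFiniteMeasure p] {f : X → ℂ}
    (C : NNReal) (h : ∀ B, MeasurableSet B → ‖ν B‖ ≤ C * p.real B) (hf : Integrable f p) :
    ν.variation ≤ C • p ∧ ν.Integrable f := by
  have h1 : ν.variation ≤ C • p := by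
    refine VectorMeasure.variation_le_of_forall_enorm_le fun B hB => ?_
    rw [Measure.smul_apply, ← ofReal_norm, ENNReal.smul_def, smul_eq_mul,
      ← ENNReal.ofReal_toReal (measure_ne_top p B), ← ENNReal.ofReal_coe_nnreal,
      ← ENNReal.ofReal_mul (NNReal.coe_nonneg C)]
    exact ENNReal.ofReal_le_ofReal (h B hB)
  exact ⟨h1, Integrable.of_measure_le_smul (c := C) ENNReal.coe_ne_top
    (by simpa using h1) hf⟩

/-- The integral against a finite complex combination of finite positive measures. -/
theorem integral_eq_sum {ι : Type*} (s : Finset ι) (c : ι → ℂ) (p : ι → Measure X)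
    [∀ i, IsFiniteMeasure (p i)] (ν : ComplexMeasure X)
    (h : ∀ B, MeasurableSet B → ν B = ∑ i ∈ s, c i * (p i).real B) {f : X → ℂ}
    (hf : ∀ i, Integrable f (p i)) :
    ν.Integrable f ∧
    ν.integral f (ContinuousLinearMap.mul ℝ ℂ) = ∑ i ∈ s, c i * ∫ x, f x ∂(p i) := by
  set P : Measure X := ∑ i ∈ s, p i with hP
  have hle : ∀ i ∈ s, p i ≤ P := fun i hi => by
    rw [hP]; exact Finset.single_le_sum (f := p) (fun _ _ => Measure.zero_le _) hi
  have hfP : Integrable f P := by rw [hP, integrable_finsetSum_measure]; exact fun i _ => hf i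
  have hb : ∀ B, MeasurableSet B → ‖ν B‖ ≤ (∑ i ∈ s, ‖c i‖₊ : NNReal) * P.real B := by
    intro B hB
    rw [h B hB]
    refine (norm_sum_le _ _).trans ?_
    push_cast
    rw [Finset.sum_mul]
    refine Finset.sum_le_sum fun i hi => ?_
    rw [norm_mul]
    have : (p i).real B ≤ P.real B := by
      simp only [Measure.real]
      exact ENNReal.toReal_mono (measure_ne_top P B) (hle i hi B)
    simp only [Complex.norm_real, Real.norm_eq_abs, abs_of_nonneg measureReal_nonneg]
    gcongr
  obtain ⟨hvar, -⟩ := integrable_of_le _ hb hfP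
  refine ⟨(integrable_of_le _ hb hfP).2, ?_⟩
  have hint : ∀ g, Integrable g P → ν.Integrable g := fun g hg => (integrable_of_le _ hb hg).2
  have hintp : ∀ g : X → ℂ, Integrable g P → ∀ i ∈ s, Integrable g (p i) := fun g hg i hi =>
    hg.mono_measure (hle i hi)
  have hs : ∀ i ∈ s, IsFiniteMeasure (p i) := fun i _ => inferInstance
  refine Integrable.induction (μ := P) (fun f => ν.integral f (ContinuousLinearMap.mul ℝ ℂ)
    = ∑ i ∈ s, c i * ∫ x, f x ∂(p i)) ?_ ?_ ?_ ?_ hfP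
  · intro a B hB _
    have hvB : ν.variation B ≠ ⊤ := by
      refine ((hvar B).trans_lt ?_).ne
      exact measure_lt_top _ _
    have h1 : ν.integral (B.indicator fun _ => a) (ContinuousLinearMap.mul ℝ ℂ) = a * ν B := by
      rw [VectorMeasure.integral_eq_setToFun, setToFun_indicator_const _ hB hvB]
      rfl
    rw [h1, h B hB, Finset.mul_sum]
    refine Finset.sum_congr rfl fun i _ => ?_
    rw [integral_indicator_const _ hB]
    simp; ring
  · intro f g _ hf hg h1 h2
    rw [VectorMeasure.integral_add (hint f hf) (hint g hg), h1, h2, ← Finset.sum_add_distrib]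
    refine Finset.sum_congr rfl fun i hi => ?_
    rw [← mul_add, ← integral_add (hintp f hf i hi) (hintp g hg i hi)]
    rfl
  · have hT := (dominatedFinMeasAdditive_cbmApplyMeasure ν (ContinuousLinearMap.mul ℝ ℂ)).of_measure_le_smul
      (c := ((∑ i ∈ s, ‖c i‖₊ : NNReal) : ENNReal)) ENNReal.coe_ne_top hvar
        (ContinuousLinearMap.opNorm_nonneg _)
    have hC : ((∑ i ∈ s, ‖c i‖₊ : NNReal) : ENNReal) ≠ ⊤ := ENNReal.coe_ne_top
    have e1 : (fun f : X →₁[P] ℂ => ν.integral f (ContinuousLinearMap.mul ℝ ℂ))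
        = fun f : X →₁[P] ℂ => setToFun P _ hT f := by
      funext f
      rw [VectorMeasure.integral_eq_setToFun]
      exact (setToFun_congr_measure_of_integrable _ hC hvar hT _ _
        (L1.integrable_coeFn f)).symm
    have e2 : ∀ i ∈ s, Continuous fun f : X →₁[P] ℂ => ∫ x, f x ∂(p i) := by
      intro i hi
      have h1 : p i ≤ (1 : ENNReal) • P := by simpa using hle i hi
      have hT' := DominatedFinMeasAdditive.of_measure_le (hle i hi)
        (dominatedFinMeasAdditive_weightedSMul (F := ℂ) (p i)) zero_le_one
      have : (fun f : X →₁[P] ℂ => ∫ x, f x ∂(p i)) = fun f : X →₁[P] ℂ => setToFun P _ hT' f := by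
        funext f
        rw [integral_eq_setToFun]
        exact (setToFun_congr_measure_of_integrable 1 ENNReal.one_ne_top h1 hT' _ _
          (L1.integrable_coeFn f)).symm
      rw [this]
      exact continuous_setToFun hT'
    refine isClosed_eq ?_ (continuous_finsetSum _ fun i hi => continuous_const.mul (e2 i hi))
    rw [e1]
    exact continuous_setToFun hT
  · intro f g hfg hf h1
    have e1 : ν.integral g (ContinuousLinearMap.mul ℝ ℂ)
        = ν.integral f (ContinuousLinearMap.mul ℝ ℂ) := by
      refine VectorMeasure.integral_congr_ae ?_
      have : ν.variation ≪ P := Measure.absolutelyContinuous_of_le_smul hvar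
      exact this.ae_eq hfg.symm
    rw [e1, h1]
    refine Finset.sum_congr rfl fun i hi => ?_
    congr 1
    exact integral_congr_ae ((Measure.absolutelyContinuous_of_le (hle i hi)).ae_eq hfg)


variable [MetricSpace X] [CompactSpace X] [BorelSpace X]

section Construction
/-! Construction of a projection-valued measure from a unital `*`-homomorphism `Φ` on `C(X, ℝ)`:
the positive measures `μ_v` with `∫ g dμ_v = ⟨Φ g v, v⟩` come from the Riesz–Markov–Kakutani
theorem, and `E B v` is the limit of `Φ (g n) v` along continuous `g n` tending to the indicator
of `B`. -/

variable (Φ : C(X, ℝ) →⋆ₐ[ℝ] (H →L[ℂ] H))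

theorem inner_map_map (g : C(X, ℝ)) (v w : H) : ⟪Φ g v, w⟫_ℂ = ⟪v, Φ g w⟫_ℂ := by
  have h : star (Φ g) = Φ g := by rw [← map_star, star_trivial]
  rw [ContinuousLinearMap.star_eq_adjoint] at h
  conv_rhs => rw [← h]
  rw [ContinuousLinearMap.adjoint_inner_right]

theorem normSq_map (g : C(X, ℝ)) (v : H) : ⟪v, Φ (g * g) v⟫_ℂ = ((‖Φ g v‖ ^ 2 : ℝ) : ℂ) := by
  rw [map_mul, mul_apply_eq_comp, ← inner_map_map, inner_self_eq_norm_sq_to_K]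
  simp

theorem inner_map_real (g : C(X, ℝ)) (v : H) :
    ((⟪v, Φ g v⟫_ℂ).re : ℂ) = ⟪v, Φ g v⟫_ℂ := by
  apply Complex.conj_eq_iff_re.mp
  rw [inner_conj_symm, inner_map_map]

theorem inner_map_nonneg (g : C(X, ℝ)) (hg : ∀ x, 0 ≤ g x) (v : H) : 0 ≤ (⟪v, Φ g v⟫_ℂ).re := by
  have : g = (⟨fun x => √(g x), by fun_prop⟩ : C(X, ℝ)) * ⟨fun x => √(g x), by fun_prop⟩ := by
    ext x; simp [Real.mul_self_sqrt (hg x)]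
  rw [this, normSq_map, Complex.ofReal_re]
  positivity

/-- The positive functional `g ↦ ⟨Φ g v, v⟩`. -/
noncomputable def vecFunctional (v : H) : CompactlySupportedContinuousMap X ℝ →ₚ[ℝ] ℝ :=
  PositiveLinearMap.mk₀
    { toFun := fun g => (⟪v, Φ g.toContinuousMap v⟫_ℂ).re
      map_add' := fun f g => by
        have : (f + g).toContinuousMap = f.toContinuousMap + g.toContinuousMap := rfl
        simp [this]
      map_smul' := fun c g => by
        have : (c • g).toContinuousMap = c • g.toContinuousMap := rfl
        simp only [this, map_smul, RingHom.id_apply]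
        rw [smul_apply, ← Complex.coe_smul, inner_smul_right]
        simp }
    (fun g hg => inner_map_nonneg Φ _ (fun x => hg x) v)

/-- The positive measure `μ_v` with `∫ g dμ_v = ⟨Φ g v, v⟩`. -/
noncomputable def vecMeasure (v : H) : Measure X := RealRMK.rieszMeasure (vecFunctional Φ v)

instance (v : H) : IsFiniteMeasure (vecMeasure Φ v) := by
  unfold vecMeasure; infer_instance

theorem cont_integrable (p : Measure X) [IsFiniteMeasure p] (g : C(X, ℝ)) : Integrable g p :=
  (BoundedContinuousFunction.mkOfCompact g).integrable p

theorem integral_vecMeasure (v : H) (g : C(X, ℝ)) :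
    ∫ x, g x ∂(vecMeasure Φ v) = (⟪v, Φ g v⟫_ℂ).re :=
  RealRMK.integral_rieszMeasure (vecFunctional Φ v)
    ⟨g, HasCompactSupport.of_compactSpace _⟩

/-- Sequences of continuous functions with values in `[0,1]` converging to the indicator function
of `B` in `L¹` of the measure of `v`. -/
structure Approx (B : Set X) (g : ℕ → C(X, ℝ)) (v : H) : Prop where
  mem : ∀ n x, 0 ≤ g n x ∧ g n x ≤ 1
  lim : Tendsto (fun n => ∫ x, |g n x - B.indicator 1 x| ∂(vecMeasure Φ v)) atTop (𝓝 0)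

theorem ind_integrable (p : Measure X) [IsFiniteMeasure p] {B : Set X} (hB : MeasurableSet B) :
    Integrable (B.indicator (1 : X → ℝ)) p :=
  (integrable_const (1 : ℝ)).indicator hB

theorem diff_integrable (p : Measure X) [IsFiniteMeasure p] {B : Set X} (hB : MeasurableSet B)
    (g : C(X, ℝ)) : Integrable (fun x => |g x - B.indicator 1 x|) p :=
  ((cont_integrable p g).sub (ind_integrable p hB)).abs

theorem exists_approx {B : Set X} (hB : MeasurableSet B) (s : Finset H) :
    ∃ g, ∀ v ∈ s, Approx Φ B g v := by
  set P : Measure X := ∑ v ∈ s, vecMeasure Φ v with hP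
  have : IsFiniteMeasure P := by rw [hP]; infer_instance
  have key : ∀ n : ℕ, ∃ g : C(X, ℝ), (∀ x, 0 ≤ g x ∧ g x ≤ 1) ∧
      ∫ x, |g x - B.indicator 1 x| ∂P ≤ 1 / ((n : ℝ) + 1) := by
    intro n
    obtain ⟨g, hg, hgi⟩ := (ind_integrable P hB).exists_boundedContinuous_integral_sub_le
      (ε := 1 / ((n : ℝ) + 1)) (by positivity)
    refine ⟨⟨fun x => max 0 (min 1 (g x)), by fun_prop⟩,
      fun x => ⟨le_max_left _ _, max_le zero_le_one (min_le_left _ _)⟩, le_trans ?_ hg⟩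
    refine integral_mono (diff_integrable P hB _) ((ind_integrable P hB).sub hgi).norm fun x => ?_
    simp only [ContinuousMap.coe_mk, Real.norm_eq_abs]
    clear hg
    by_cases hx : x ∈ B
    · rw [Set.indicator_of_mem hx, Pi.one_apply, abs_sub_comm 1]
      rcases le_total 1 (g x) with h | h
      · simp [h]
      · have h' : max 0 (g x) ≤ 1 := max_le zero_le_one h
        rw [min_eq_right h, abs_sub_comm, abs_sub_comm (g x), abs_of_nonneg (by linarith),
          abs_of_nonneg (by linarith)]
        linarith [le_max_right 0 (g x)]
    · rw [Set.indicator_of_notMem hx, sub_zero, zero_sub, abs_neg,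
        abs_of_nonneg (le_max_left _ _)]
      exact max_le (abs_nonneg _) ((min_le_right _ _).trans (le_abs_self _))
  choose g hg1 hg2 using key
  refine ⟨g, fun v hv => ⟨hg1, ?_⟩⟩
  refine squeeze_zero (fun n => integral_nonneg fun x => abs_nonneg _) (fun n => ?_)
    tendsto_one_div_add_atTop_nhds_zero_nat
  refine le_trans ?_ (hg2 n)
  refine integral_mono_measure ?_ (Eventually.of_forall fun x => abs_nonneg _)
    (diff_integrable P hB _)
  rw [hP]
  exact Finset.single_le_sum (f := fun v => vecMeasure Φ v) (fun _ _ => Measure.zero_le _) hv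

theorem normSq_eq (g : C(X, ℝ)) (v : H) : ‖Φ g v‖ ^ 2 = ∫ x, g x * g x ∂(vecMeasure Φ v) := by
  have := integral_vecMeasure Φ v (g * g)
  rw [normSq_map, Complex.ofReal_re] at this
  rw [← this]; rfl

theorem norm_map_le (g : C(X, ℝ)) (hg : ∀ x, 0 ≤ g x ∧ g x ≤ 1) (v : H) : ‖Φ g v‖ ≤ ‖v‖ := by
  refine (sq_le_sq₀ (norm_nonneg _) (norm_nonneg _)).1 ?_
  have h1 := normSq_eq Φ 1 v
  rw [map_one] at h1
  rw [normSq_eq, show ‖v‖ = ‖(1 : H →L[ℂ] H) v‖ by simp, h1]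
  refine integral_mono (cont_integrable _ (g * g)) (cont_integrable _ (1 * 1 : C(X, ℝ)))
    fun x => ?_
  have := hg x
  simp only [ContinuousMap.one_apply]
  nlinarith

theorem dist_sq_le {B : Set X} (hB : MeasurableSet B) (f g : C(X, ℝ))
    (hf : ∀ x, 0 ≤ f x ∧ f x ≤ 1) (hg : ∀ x, 0 ≤ g x ∧ g x ≤ 1) (v : H) :
    ‖Φ f v - Φ g v‖ ^ 2 ≤ ∫ x, |f x - B.indicator 1 x| ∂(vecMeasure Φ v)
      + ∫ x, |g x - B.indicator 1 x| ∂(vecMeasure Φ v) := by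
  rw [← sub_apply, ← map_sub, normSq_eq,
    ← integral_add (diff_integrable _ hB _) (diff_integrable _ hB _)]
  refine integral_mono (cont_integrable _ ((f - g) * (f - g)))
    ((diff_integrable _ hB _).add (diff_integrable _ hB _)) fun x => ?_
  have h1 := hf x
  have h2 := hg x
  simp only [ContinuousMap.sub_apply]
  have h3 : |f x - g x| ≤ |f x - B.indicator 1 x| + |g x - B.indicator 1 x| := by
    rw [abs_sub_comm (g x)]; exact abs_sub_le _ _ _
  have h4 : |f x - g x| ≤ 1 := by rw [abs_le]; constructor <;> linarith
  rw [← abs_mul_abs_self]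
  nlinarith [abs_nonneg (f x - g x)]

theorem exists_limit {B : Set X} (hB : MeasurableSet B) (v : H) :
    ∃ w, ∀ g, Approx Φ B g v → Tendsto (fun n => Φ (g n) v) atTop (𝓝 w) := by
  obtain ⟨g₀, h₀⟩ := exists_approx Φ hB {v}
  replace h₀ := h₀ v (by simp)
  have hc : CauchySeq fun n => Φ (g₀ n) v := by
    rw [Metric.cauchySeq_iff]
    intro ε hε
    obtain ⟨N, hN⟩ := eventually_atTop.1 (h₀.lim.eventually_lt_const
      (show (0 : ℝ) < ε ^ 2 / 2 by positivity))
    refine ⟨N, fun m hm n hn => ?_⟩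
    rw [dist_eq_norm]
    refine lt_of_pow_lt_pow_left₀ 2 hε.le ?_
    have := dist_sq_le Φ hB _ _ (h₀.mem m) (h₀.mem n) v
    linarith [hN m hm, hN n hn]
  obtain ⟨w, hw⟩ := cauchySeq_tendsto_of_complete hc
  refine ⟨w, fun g hg => ?_⟩
  have h0 : Tendsto (fun n => Φ (g n) v - Φ (g₀ n) v) atTop (𝓝 0) := by
    rw [tendsto_zero_iff_norm_tendsto_zero]
    have h1 : Tendsto (fun n => ‖Φ (g n) v - Φ (g₀ n) v‖ ^ 2) atTop (𝓝 0) :=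
      squeeze_zero (fun n => by positivity)
        (fun n => dist_sq_le Φ hB _ _ (hg.mem n) (h₀.mem n) v) (by simpa using hg.lim.add h₀.lim)
    have h2 := (Real.continuous_sqrt.tendsto 0).comp h1
    simpa [Function.comp_def, Real.sqrt_sq] using h2
  simpa using h0.add hw

open Classical in
/-- The vector `E B v`. -/
noncomputable def projFun (B : Set X) (v : H) : H :=
  if hB : MeasurableSet B then (exists_limit Φ hB v).choose else 0

theorem projFun_tendsto {B : Set X} (hB : MeasurableSet B) {v : H} {g : ℕ → C(X, ℝ)}
    (h : Approx Φ B g v) : Tendsto (fun n => Φ (g n) v) atTop (𝓝 (projFun Φ B v)) := by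
  rw [projFun, dif_pos hB]
  exact (exists_limit Φ hB v).choose_spec g h

open Classical in
/-- The operator `E B`. -/
noncomputable def projMap (B : Set X) : H →L[ℂ] H :=
  if hB : MeasurableSet B then
    LinearMap.mkContinuous
      { toFun := projFun Φ B
        map_add' := fun v w => by
          obtain ⟨g, hg⟩ := exists_approx Φ hB {v, w, v + w}
          refine tendsto_nhds_unique (projFun_tendsto Φ hB (hg (v + w) (by simp))) ?_
          simpa using (projFun_tendsto Φ hB (hg v (by simp))).add
            (projFun_tendsto Φ hB (hg w (by simp)))
        map_smul' := fun c v => by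
          obtain ⟨g, hg⟩ := exists_approx Φ hB {v, c • v}
          refine tendsto_nhds_unique (projFun_tendsto Φ hB (hg (c • v) (by simp))) ?_
          simpa using (projFun_tendsto Φ hB (hg v (by simp))).const_smul c } 1
      (fun v => by
        obtain ⟨g, hg⟩ := exists_approx Φ hB {v}
        rw [one_mul]
        exact le_of_tendsto (projFun_tendsto Φ hB (hg v (by simp))).norm
          (Eventually.of_forall fun n => norm_map_le Φ _ ((hg v (by simp)).mem n) v))
  else 0

theorem projMap_tendsto {B : Set X} (hB : MeasurableSet B) {v : H} {g : ℕ → C(X, ℝ)}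
    (h : Approx Φ B g v) : Tendsto (fun n => Φ (g n) v) atTop (𝓝 (projMap Φ B v)) := by
  rw [projMap, dif_pos hB]
  exact projFun_tendsto Φ hB h

theorem projMap_inner_self {B : Set X} (hB : MeasurableSet B) (v : H) :
    ⟪v, projMap Φ B v⟫_ℂ = ((vecMeasure Φ v).real B : ℂ) := by
  obtain ⟨g, hg⟩ := exists_approx Φ hB {v}
  replace hg := hg v (by simp)
  have h1 : Tendsto (fun n => ⟪v, Φ (g n) v⟫_ℂ) atTop (𝓝 ⟪v, projMap Φ B v⟫_ℂ) :=
    tendsto_const_nhds.inner (projMap_tendsto Φ hB hg)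
  refine tendsto_nhds_unique h1 ?_
  have h2 : ∀ n, ⟪v, Φ (g n) v⟫_ℂ = ((∫ x, g n x ∂(vecMeasure Φ v) : ℝ) : ℂ) := fun n => by
    rw [integral_vecMeasure, inner_map_real]
  simp only [h2]
  refine (Complex.continuous_ofReal.tendsto _).comp ?_
  rw [tendsto_iff_norm_sub_tendsto_zero]
  refine squeeze_zero (fun n => norm_nonneg _) (fun n => ?_) hg.lim
  rw [← integral_indicator_one hB, ← integral_sub (cont_integrable _ _) (ind_integrable _ hB)]
  exact norm_integral_le_integral_norm _

open Classical in
theorem projMap_adjoint {B : Set X} (hB : MeasurableSet B) (v w : H) :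
    ⟪projMap Φ B v, w⟫_ℂ = ⟪v, projMap Φ B w⟫_ℂ := by
  obtain ⟨g, hg⟩ := exists_approx Φ hB {v, w}
  refine tendsto_nhds_unique
    ((projMap_tendsto Φ hB (hg v (by simp))).inner tendsto_const_nhds) ?_
  simp only [inner_map_map]
  exact tendsto_const_nhds.inner (projMap_tendsto Φ hB (hg w (by simp)))

open Classical in
theorem projMap_inter {A B : Set X} (hA : MeasurableSet A) (hB : MeasurableSet B) :
    projMap Φ (A ∩ B) = projMap Φ A * projMap Φ B := by
  ext v
  obtain ⟨b, hb⟩ := exists_approx Φ hB {v}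
  replace hb := hb v (by simp)
  obtain ⟨a, ha⟩ := exists_approx Φ hA {v, projMap Φ B v}
  have ha1 := ha v (by simp)
  have ha2 := ha (projMap Φ B v) (by simp)
  have hab : Approx Φ (A ∩ B) (fun n => a n * b n) v := by
    refine ⟨fun n x => ⟨mul_nonneg (ha1.mem n x).1 (hb.mem n x).1,
      mul_le_one₀ (ha1.mem n x).2 (hb.mem n x).1 (hb.mem n x).2⟩, ?_⟩
    refine squeeze_zero (fun n => integral_nonneg fun x => abs_nonneg _) (fun n => ?_)
      (by simpa using ha1.lim.add hb.lim)
    rw [← integral_add (diff_integrable _ hA _) (diff_integrable _ hB _)]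
    refine integral_mono (diff_integrable _ (hA.inter hB) _)
      ((diff_integrable _ hA _).add (diff_integrable _ hB _)) fun x => ?_
    have h1 := ha1.mem n x
    have h2 := hb.mem n x
    by_cases hxA : x ∈ A <;> by_cases hxB : x ∈ B <;>
      simp [hxA, hxB, abs_mul, abs_of_nonneg h1.1, abs_of_nonneg h2.1]
    · rw [abs_sub_comm, abs_of_nonneg (by nlinarith), abs_sub_comm, abs_of_nonneg (by linarith),
        abs_sub_comm, abs_of_nonneg (by linarith)]
      nlinarith
    · nlinarith [abs_nonneg (a n x - 1)]
    · nlinarith [abs_nonneg (b n x - 1)]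
    · nlinarith
  refine tendsto_nhds_unique (projMap_tendsto Φ (hA.inter hB) hab) ?_
  have h1 : Tendsto (fun n => Φ (a n) (Φ (b n) v - projMap Φ B v)) atTop (𝓝 0) := by
    rw [tendsto_zero_iff_norm_tendsto_zero]
    exact squeeze_zero (fun n => norm_nonneg _) (fun n => norm_map_le Φ _ (ha1.mem n) _)
      (tendsto_iff_norm_sub_tendsto_zero.1 (projMap_tendsto Φ hB hb))
  simpa using h1.add (projMap_tendsto Φ hA ha2)

theorem polar (T : H →L[ℂ] H) (v w : H) : ⟪w, T v⟫_ℂ =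
    ∑ i : Fin 4, ![1 / 4, -1 / 4, Complex.I / 4, -Complex.I / 4] i *
      ⟪![v + w, v - w, v + Complex.I • w, v - Complex.I • w] i,
        T (![v + w, v - w, v + Complex.I • w, v - Complex.I • w] i)⟫_ℂ := by
  simp only [Fin.sum_univ_four, Matrix.cons_val]
  simp only [map_add, map_sub, map_smul, inner_add_left, inner_add_right, inner_sub_left,
    inner_sub_right, inner_smul_left, inner_smul_right, Complex.conj_I]
  linear_combination (1 / 2 * ⟪w, T v⟫_ℂ - 1/2 * ⟪v, T w⟫_ℂ) * Complex.I_sq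

/-- The projection-valued measure of `Φ`. -/
noncomputable def constructedPVM : ProjectionValuedMeasure X H where
  proj := projMap Φ
  isStarProjection B hB := by
    refine ⟨?_, ?_⟩
    · rw [IsIdempotentElem, ← projMap_inter Φ hB hB, Set.inter_self]
    · rw [ContinuousLinearMap.isSelfAdjoint_iff_isSymmetric]
      exact fun v w => projMap_adjoint Φ hB v w
  proj_empty := by
    refine ContinuousLinearMap.ext fun v => ?_
    refine tendsto_nhds_unique (projMap_tendsto Φ MeasurableSet.empty (g := fun _ => 0)
      ⟨fun n x => by simp, by simp⟩) ?_
    simp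
  proj_univ := by
    refine ContinuousLinearMap.ext fun v => ?_
    refine tendsto_nhds_unique (projMap_tendsto Φ MeasurableSet.univ (g := fun _ => 1)
      ⟨fun n x => by simp, by simp⟩) ?_
    simp
  proj_inter A B hA hB := projMap_inter Φ hA hB
  hasSum_inner B hB hd v w := by
    simp only [polar _ v w]
    refine hasSum_sum fun i _ => HasSum.mul_left _ ?_
    rw [projMap_inner_self Φ (MeasurableSet.iUnion hB)]
    simp only [projMap_inner_self Φ (hB _)]
    refine Complex.hasSum_ofReal.2 ?_
    simp only [Measure.real]
    rw [measure_iUnion hd hB]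
    refine (ENNReal.summable_toReal ?_).hasSum_iff.2 ?_
    · rw [← measure_iUnion hd hB]; exact measure_ne_top _ _
    · exact (ENNReal.tsum_toReal_eq fun n => measure_ne_top _ _).symm

theorem integral_constructedPVM (g : C(X, ℝ)) (v w : H) :
    ((constructedPVM Φ).complexMeasure v w).integral (fun x => (g x : ℂ))
      (ContinuousLinearMap.mul ℝ ℂ) = ⟪w, Φ g v⟫_ℂ := by
  rw [polar (Φ g) v w]
  refine (integral_eq_sum Finset.univ ![1 / 4, -1 / 4, Complex.I / 4, -Complex.I / 4] (fun i => vecMeasure Φ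
    (![v + w, v - w, v + Complex.I • w, v - Complex.I • w] i)) _ (fun B hB => ?_)
    (fun i => (cont_integrable _ g).ofReal)).2.trans ?_
  · rw [ProjectionValuedMeasure.complexMeasure_apply _ _ _ hB, polar]
    simp only [← projMap_inner_self Φ hB]
    rfl
  · refine Finset.sum_congr rfl fun i _ => ?_
    have h1 : ∫ x, (g x : ℂ) ∂(vecMeasure Φ
        (![v + w, v - w, v + Complex.I • w, v - Complex.I • w] i)) = _ := integral_ofReal
    refine congrArg _ (h1.trans (Eq.trans ?_ (inner_map_real Φ g _)))
    exact congrArg _ (integral_vecMeasure Φ _ g)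

end Construction

/-- `E` is a spectral measure of `T`: it lives on the spectrum of `T` and `T = ∫ λ dE(λ)`, that is,
`∫ λ d⟨E(λ) v, w⟩ = ⟨T v, w⟩` for all `v`, `w`. (The spectrum of a self-adjoint operator is real,
so `spectrum ℝ T` is the usual spectrum.) -/
def IsSpectralMeasure (T : H →L[ℂ] H) (E : ProjectionValuedMeasure (spectrum ℝ T) H) : Prop :=
  ∀ v w : H, (E.complexMeasure v w).integral (fun l : spectrum ℝ T => ((l : ℝ) : ℂ))
    (ContinuousLinearMap.mul ℝ ℂ) = ⟪w, T v⟫_ℂ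

/-- The spectral measure of a bounded self-adjoint operator `T`, obtained from the continuous
functional calculus of `T`; `isSpectralMeasure_spectralMeasure` shows that `T = ∫ λ dE(λ)`. -/
noncomputable def spectralMeasure (T : H →L[ℂ] H) (hT : IsSelfAdjoint T) :
    ProjectionValuedMeasure (spectrum ℝ T) H :=
  constructedPVM (cfcHom (R := ℝ) hT)

theorem isSpectralMeasure_spectralMeasure (T : H →L[ℂ] H) (hT : IsSelfAdjoint T) :
    IsSpectralMeasure T (spectralMeasure T hT) := fun v w => by
  have := integral_constructedPVM (cfcHom (R := ℝ) hT)
    ((ContinuousMap.id ℝ).restrict (spectrum ℝ T)) v w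
  rwa [cfcHom_id] at this

end Spectral

section Graph

variable {V : Type*} (G : SimpleGraph V) [G.LocallyFinite]


/-- The adjacency operator `(A f)(x) = ∑_{y ~ x} f y`. The operators of a locally finite graph are
written here on all functions on the vertices; they restrict to `ℓ²` when degrees are bounded. -/
noncomputable def adjOp : Module.End ℂ (V → ℂ) where
  toFun f x := ∑ y ∈ G.neighborFinset x, f y
  map_add' f g := by ext x; simp [Finset.sum_add_distrib]
  map_smul' c f := by ext x; simp [Finset.mul_sum]

/-- The valency operator `(D f)(x) = deg(x) f(x)`. -/
noncomputable def degOp : Module.End ℂ (V → ℂ) where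
  toFun f x := (G.degree x : ℂ) * f x
  map_add' f g := by ext x; simp [mul_add]
  map_smul' c f := by ext x; simp; ring

/-- The Laplacian `D - A`. -/
noncomputable def lapOp : Module.End ℂ (V → ℂ) := degOp G - adjOp G

open Classical in
/-- The bump count of a path `(e_1, …, e_n)`: the number of `i ∈ {1, …, n-1}` such that `e_i` is
the inverse of `e_{i+1}`. -/
noncomputable def bumpCount {x y : V} (p : G.Walk x y) : ℕ :=
  (p.darts.zip p.darts.tail).countP fun e => decide (e.1 = e.2.symm)

/-- The paths of length `m` that start at `x` (with their end point). -/
abbrev PathFrom (x : V) (m : ℕ) : Type _ := {p : Σ y, G.Walk x y // p.2.length = m}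

instance finite_pathFrom (x : V) (m : ℕ) : Finite (PathFrom G x m) := by
  induction m generalizing x with
  | zero =>
    have : Subsingleton (PathFrom G x 0) := by
      refine ⟨?_⟩
      rintro ⟨⟨y, p⟩, hp⟩ ⟨⟨z, p'⟩, hp'⟩
      cases p with
      | cons h p => simp at hp
      | nil =>
        cases p' with
        | cons h p => simp at hp'
        | nil => rfl
    infer_instance
  | succ m ih =>
    have hN : Finite (G.neighborSet x) := inferInstance
    refine Finite.of_surjective
      (α := Σ y : G.neighborSet x, PathFrom G y m)
      (fun s => ⟨⟨s.2.1.1, SimpleGraph.Walk.cons s.1.2 s.2.1.2⟩, congrArg (· + 1) s.2.2⟩) ?_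
    rintro ⟨⟨y, p⟩, hp⟩
    cases p with
    | nil => simp at hp
    | cons h p => exact ⟨⟨⟨_, h⟩, ⟨⟨_, p⟩, by simpa using hp⟩⟩, rfl⟩

noncomputable instance (x : V) (m : ℕ) : Fintype (PathFrom G x m) := Fintype.ofFinite _

/-- The operator `C_m(t)`: `(C_m(t) f)(x)` is the sum of `t ^ bc(C) * f(end of C)` over all paths
`C` of length `m` starting at `x`. -/
noncomputable def pathOp (t : ℂ) (m : ℕ) : Module.End ℂ (V → ℂ) where
  toFun f x := ∑ p : PathFrom G x m, t ^ bumpCount G p.1.2 * f p.1.1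
  map_add' f g := by ext x; simp [mul_add, Finset.sum_add_distrib]
  map_smul' c f := by
    ext x
    simp only [Pi.smul_apply, smul_eq_mul, Finset.mul_sum, RingHom.id_apply]
    exact Finset.sum_congr rfl fun p _ => by ring

open Classical in
/-- The matrix coefficient `B(x₁, x₂) = (B δ_{x₁})(x₂)`. -/
noncomputable def entry {V : Type*} (B : Module.End ℂ (V → ℂ)) (x₁ x₂ : V) : ℂ := B (Pi.single x₁ 1) x₂

/-- The operator `Q(t) = D - (1 - t) I`. -/
noncomputable def Qop (t : ℂ) : Module.End ℂ (V → ℂ) := degOp G - (1 - t) • 1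

/-- `R_m(t)(x) = ∑_{j=1}^{⌈m/2⌉-1} ∑_{i=1}^{j} (1-t)^{2(j-i)} (1-t²)^{i-1} [Δ C_{m-2j}(t)](x, x)`,
where the Laplacian acts on the function `y ↦ C_{m-2j}(t)(y, y)`. -/
noncomputable def Rfun (t : ℂ) (m : ℕ) (x : V) : ℂ :=
  ∑ j ∈ Finset.Icc 1 (⌈(m : ℚ) / 2⌉₊ - 1), ∑ i ∈ Finset.Icc 1 j,
    (1 - t) ^ (2 * (j - i)) * (1 - t ^ 2) ^ (i - 1) *
      lapOp G (fun y => entry (pathOp G t (m - 2 * j)) y y) x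

/-- The operator of multiplication by `R_m(t)(x)`. -/
noncomputable def Rop (t : ℂ) (m : ℕ) : Module.End ℂ (V → ℂ) where
  toFun f x := Rfun G t m x * f x
  map_add' f g := by ext x; simp [mul_add]
  map_smul' c f := by ext x; simp; ring

/-- The operator `C_m^{cbc}(t)`. -/
noncomputable def cbcOp (t : ℂ) : ℕ → Module.End ℂ (V → ℂ)
  | 0 => pathOp G t 0
  | 1 => pathOp G t 1
  | 2 => t • pathOp G t 2
  | m + 3 =>
    pathOp G t (m + 3)
      - ((1 - t)⁻¹ • (Qop G t - (1 - t) • 1)) *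
          ∑ j ∈ Finset.Icc 1 (⌈((m + 3 : ℕ) : ℚ) / 2⌉₊ - 1),
            (1 - t) ^ (2 * j) • pathOp G t (m + 3 - 2 * j)
      + (1 - t) • Rop G t (m + 3)
      - ((if Even (m + 3) then 1 else 0) * (1 - t) ^ (m + 3 - 1) * t) • degOp G

/-- The Bartholdi zeta function
`Z_X(u, t, x₀, x) = exp (∑_{m ≥ 1} C_m^{cbc}(t)(x₀, x) u^m / m)`. -/
noncomputable def bartholdiZeta (u t : ℂ) (x₀ x : V) : ℂ :=
  Complex.exp (∑' m : ℕ, entry (cbcOp G t (m + 1)) x₀ x / (m + 1 : ℂ) * u ^ (m + 1))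

/-- The maximum `M` of the degrees (for a graph of bounded degree). -/
noncomputable def maxDegree : ℕ := ⨆ x, G.degree x

/-- `α(t) = (M + √(M² + 4 (|t| + 1) M)) / 2`. -/
noncomputable def alpha (t : ℂ) : ℝ :=
  (maxDegree G + √((maxDegree G : ℝ) ^ 2 + 4 * (‖t‖ + 1) * maxDegree G)) / 2

/-- The degrees of the graph are bounded. -/
def BoundedDegree : Prop := BddAbove (Set.range fun x => G.degree x)

theorem sum_sq_adj (M : ℕ) (hM : ∀ x, G.degree x ≤ M) (a : V → ENNReal) :
    ∑' x, ∑ y ∈ G.neighborFinset x, a y ≤ M * ∑' x, a x := by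
  classical
  have h1 : ∀ x, ∑ y ∈ G.neighborFinset x, a y = ∑' y, if G.Adj x y then a y else 0 := by
    intro x
    rw [tsum_eq_sum (s := G.neighborFinset x) (fun y hy => if_neg (by simpa using hy))]
    exact Finset.sum_congr rfl fun y hy => by simp_all
  simp only [h1]
  rw [ENNReal.tsum_comm, ← ENNReal.tsum_mul_left]
  refine ENNReal.tsum_le_tsum fun y => ?_
  rw [tsum_eq_sum (s := G.neighborFinset y) (by
    intro x hx; simp only [SimpleGraph.mem_neighborFinset] at hx; simp [G.adj_comm, hx])]
  refine (Finset.sum_le_card_nsmul _ _ (a y) fun x _ => by split <;> simp).trans ?_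
  rw [nsmul_eq_mul]
  gcongr
  exact_mod_cast hM y

theorem lap_sq_le (M : ℕ) (hM : ∀ x, G.degree x ≤ M) (f : V → ℂ) (x : V) :
    ‖lapOp G f x‖ₑ ^ 2 ≤ 2 * M ^ 2 * ‖f x‖ₑ ^ 2
      + 2 * M * ∑ y ∈ G.neighborFinset x, ‖f y‖ₑ ^ 2 := by
  have h1 : ‖lapOp G f x‖ ^ 2 ≤ 2 * M ^ 2 * ‖f x‖ ^ 2
      + 2 * M * ∑ y ∈ G.neighborFinset x, ‖f y‖ ^ 2 := by
    have hd : (G.degree x : ℝ) ≤ M := by exact_mod_cast hM x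
    have e : lapOp G f x = G.degree x * f x - ∑ y ∈ G.neighborFinset x, f y := rfl
    have a1 : ‖lapOp G f x‖ ≤ M * ‖f x‖ + ∑ y ∈ G.neighborFinset x, ‖f y‖ := by
      rw [e]
      refine (norm_sub_le _ _).trans (add_le_add ?_ (norm_sum_le _ _))
      rw [norm_mul, Complex.norm_natCast]
      gcongr
    have a2 : (∑ y ∈ G.neighborFinset x, ‖f y‖) ^ 2
        ≤ M * ∑ y ∈ G.neighborFinset x, ‖f y‖ ^ 2 := by
      refine sq_sum_le_card_mul_sum_sq.trans ?_
      rw [SimpleGraph.card_neighborFinset_eq_degree]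
      gcongr
    have a3 : ‖lapOp G f x‖ ^ 2 ≤ (M * ‖f x‖ + ∑ y ∈ G.neighborFinset x, ‖f y‖) ^ 2 := by
      gcongr
    nlinarith [sq_nonneg (M * ‖f x‖ - ∑ y ∈ G.neighborFinset x, ‖f y‖)]
  have h2 := ENNReal.ofReal_le_ofReal h1
  rw [ENNReal.ofReal_pow (norm_nonneg _), ENNReal.ofReal_add (by positivity) (by positivity),
    ENNReal.ofReal_mul (by positivity), ENNReal.ofReal_mul (by positivity),
    ENNReal.ofReal_mul (by positivity), ENNReal.ofReal_mul (by positivity),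
    ENNReal.ofReal_sum_of_nonneg (fun _ _ => by positivity),
    ENNReal.ofReal_pow (by positivity), ENNReal.ofReal_pow (by positivity)] at h2
  simpa [ENNReal.ofReal_pow, ofReal_norm] using h2

theorem lap_tsum_le (M : ℕ) (hM : ∀ x, G.degree x ≤ M) (f : V → ℂ) :
    ∑' x, ‖lapOp G f x‖ₑ ^ 2 ≤ (2 * M) ^ 2 * ∑' x, ‖f x‖ₑ ^ 2 := by
  refine (ENNReal.tsum_le_tsum (lap_sq_le G M hM f)).trans ?_
  rw [ENNReal.tsum_add, ENNReal.tsum_mul_left, ENNReal.tsum_mul_left]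
  calc _ ≤ 2 * (M : ENNReal) ^ 2 * ∑' x, ‖f x‖ₑ ^ 2 + 2 * M * (M * ∑' x, ‖f x‖ₑ ^ 2) := by
        gcongr; exact sum_sq_adj G M hM _
    _ = _ := by ring

/-- `ℓ²(V)`. -/
noncomputable abbrev L2 (V : Type*) := lp (fun _ : V => ℂ) 2

theorem enorm_sq_L2 (f : L2 V) : ‖f‖ₑ ^ 2 = ∑' x, ‖f x‖ₑ ^ 2 := by
  have h := lp.hasSum_norm (p := 2) (by norm_num) f
  norm_num at h
  rw [← ofReal_norm, ← ENNReal.ofReal_pow (norm_nonneg _), ← h.tsum_eq,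
    ENNReal.ofReal_tsum_of_nonneg (fun _ => by positivity) h.summable]
  simp [ENNReal.ofReal_pow, ofReal_norm]

theorem memL2_iff (f : V → ℂ) : Memℓp f 2 ↔ ∑' x, ‖f x‖ₑ ^ 2 ≠ ⊤ := by
  rw [memℓp_gen_iff (by norm_num)]
  have : ∀ x, ‖f x‖ₑ ^ 2 = ENNReal.ofReal (‖f x‖ ^ 2) := fun x => by
    rw [ENNReal.ofReal_pow (norm_nonneg _), ofReal_norm]
  simp only [this]
  have e2 : (2 : ENNReal).toReal = 2 := by norm_num
  simp only [e2, Real.rpow_two]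
  refine ⟨fun h => h.tsum_ofReal_ne_top, fun h => ?_⟩
  have := ENNReal.summable_toReal h
  simpa [ENNReal.toReal_ofReal] using this

theorem exists_bound (h : BoundedDegree G) : ∃ M : ℕ, ∀ x, G.degree x ≤ M := by
  obtain ⟨M, hM⟩ := h
  exact ⟨M, fun x => hM ⟨x, rfl⟩⟩

theorem lap_mem (h : BoundedDegree G) (f : L2 V) : Memℓp (lapOp G f) 2 := by
  obtain ⟨M, hM⟩ := exists_bound G h
  rw [memL2_iff]
  refine ne_top_of_le_ne_top ?_ (lap_tsum_le G M hM f)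
  refine ENNReal.mul_ne_top (by finiteness) ((memL2_iff _).1 (lp.memℓp f))

/-- The Laplacian as a bounded operator on `ℓ²(V)`. -/
noncomputable def laplacian (h : BoundedDegree G) : L2 V →L[ℂ] L2 V :=
  LinearMap.mkContinuousOfExistsBound
    { toFun := fun f => ⟨lapOp G f, lap_mem G h f⟩
      map_add' := fun f g => Subtype.ext ((lapOp G).map_add f g)
      map_smul' := fun c f => Subtype.ext ((lapOp G).map_smul c f) }
    (by
      obtain ⟨M, hM⟩ := exists_bound G h
      refine ⟨2 * M, fun f => ?_⟩
      have h1 := lap_tsum_le G M hM f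
      have h2 := enorm_sq_L2 (V := V) ⟨lapOp G f, lap_mem G h f⟩
      rw [← enorm_sq_L2] at h1
      change _ = ∑' x, ‖lapOp G f x‖ₑ ^ 2 at h2
      rw [← h2, ← mul_pow] at h1
      have h3 := (ENNReal.pow_le_pow_left_iff (by norm_num : (2:ℕ) ≠ 0)).1 h1
      have h4 := ENNReal.toReal_mono (by finiteness) h3
      simpa using h4)

theorem laplacian_apply (h : BoundedDegree G) (f : L2 V) (x : V) :
    laplacian G h f x = lapOp G f x := rfl

open Classical in
/-- The Kronecker delta `δ_x` in `ℓ²(V)`. -/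
noncomputable def delta (x : V) : L2 V := lp.single 2 x 1

theorem delta_inner (x : V) (f : L2 V) : ⟪delta x, f⟫_ℂ = f x := by
  classical
  simp [delta, lp.inner_single_left]

theorem laplacian_delta (h : BoundedDegree G) (x : V) :
    laplacian G h (delta x)
      = (G.degree x : ℂ) • delta x - ∑ y ∈ G.neighborFinset x, delta y := by
  classical
  refine lp.ext (funext fun z => ?_)
  have e : laplacian G h (delta x) z
      = G.degree z * delta x z - ∑ y ∈ G.neighborFinset z, delta x y := rfl
  have e' : ((G.degree x : ℂ) • delta x - ∑ y ∈ G.neighborFinset x, delta y : L2 V) z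
      = G.degree x * delta x z - ∑ y ∈ G.neighborFinset x, delta y z := by
    rw [lp.coeFn_sub, lp.coeFn_smul, lp.coeFn_sum]
    exact congrArg₂ (fun a b : ℂ => a - b) rfl (Finset.sum_apply z _ _)
  rw [e, e']
  simp only [delta, lp.single_apply, Pi.single_apply]
  congr 1
  · by_cases hz : z = x
    · rw [hz]
    · simp [hz]
  · simp [G.adj_comm]

theorem isSelfAdjoint_laplacian (h : BoundedDegree G) : IsSelfAdjoint (laplacian G h) := by
  rw [ContinuousLinearMap.isSelfAdjoint_iff']
  ext f x
  rw [← delta_inner, ContinuousLinearMap.adjoint_inner_right, laplacian_delta,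
    inner_sub_left, inner_smul_left, sum_inner, delta_inner, laplacian_apply]
  simp only [delta_inner, map_natCast]
  rfl

theorem boundedDegree_of_regular {d : ℕ} (h : G.IsRegularOfDegree d) : BoundedDegree G :=
  ⟨d, by rintro _ ⟨x, rfl⟩; exact (h x).le⟩

/-- The complex measure `μ_{x₀, x}`, `dμ_{x₀, x}(λ) = d⟨E(λ) δ_{x₀}, δ_x⟩`, where `E` is the spectral
measure of the Laplacian on `ℓ²(V)`. -/
noncomputable def laplacianMeasure (h : BoundedDegree G) (x₀ x : V) :
    MeasureTheory.ComplexMeasure (spectrum ℝ (laplacian G h)) :=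
  (spectralMeasure (laplacian G h) (isSelfAdjoint_laplacian G h)).complexMeasure
    (delta x₀) (delta x)

end Graph

end Bartholdi

/-! On a regular graph every `C_m(t)` is a polynomial in the adjacency operator `A`. Adding one edge
in front of a path gives `C_{m+1} = A C_m - c C_{m-1}` for `m ≥ 2`, with `c = (1-t)(q+t)`. The
initial value `C_2 = A² - (c + (1-t)²)` carries the defect `(1-t)²`. Let `α, β` be the formal roots
of `z² - A z + c`, and put `U_m = ∑ α^i β^(m-i)` and `L_m = α^m + β^m` (`chebSeq` and `lucasSeq`).
Then `C_m = U_m - (1-t)² U_{m-2}` for `m ≥ 2` (`pathOp_add_two`).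

The sum in the definition of `C_m^cbc` therefore telescopes, leaving a multiple of `U_{m-2}` and,
for even `m`, a scalar. Since `U_m - c U_{m-2} = L_m`, the outcome for `m ≥ 3` is `C_m^cbc = L_m(A)
+ (1-t) R_m + ε_m (q-1)(1-t)^m` (`cbcOp_add_three`). The case `m = 1` fits this pattern with `R_1 =
0`. The case `m = 2` needs the extra term `(1-t)(t D - C_2)`, which is the third factor of the
formula. Nothing about `R_m` beyond its growth is used.

Multiplying by `u^m / m` and summing, the `ε_m` part is `(q-1)/2` times the power sums of `±(1-t)`,
so it gives `-(q-1)/2 · log(1-(1-t)²u²)`. The `L_m` part gives `-log(1 - A u + c u²)`, interpreted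
through the spectral measure of `Δ = (q+1) - A`: each `L_m` is a polynomial, which integrates to a
matrix coefficient, and dominated convergence allows termwise integration (`hasSum_lucasSeq`).

Convergence rests on `α(t)` being the positive root of `z² = M z + (|t|+1) M`. On the spectrum
`|q+1-λ| ≤ M`, and `|c| ≤ (|t|+1) M`, so the roots of `z² - (q+1-λ) z + c` have modulus at most
`α(t)`; also `|1-t| ≤ α(t)`, and `R_m` is `O(m² α(t)^m)`. -/

namespace Bartholdi
-- Recursion for the path operators of a regular graph
section Paths
variable {V : Type*} (G : SimpleGraph V) [G.LocallyFinite]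

open Classical in
/-- The sum of `t ^ bc(C) * f(end of C)` over the paths `C` of length `m + 1` whose first edge is
`(x, y)`, by recursion on the length. -/
noncomputable def dartSum (t : ℂ) (f : V → ℂ) : ℕ → V → V → ℂ
  | 0, _, y => f y
  | m + 1, x, y => ∑ z ∈ G.neighborFinset y, (if z = x then t else 1) * dartSum t f m y z

/-- A path of length `m + 1` is a first edge followed by a path of length `m`. -/
noncomputable def consEquiv (x : V) (m : ℕ) :
    (Σ y : G.neighborSet x, PathFrom G y m) ≃ PathFrom G x (m + 1) :=
  Equiv.ofBijective
    (fun s => ⟨⟨s.2.1.1, SimpleGraph.Walk.cons s.1.2 s.2.1.2⟩, congrArg (· + 1) s.2.2⟩) (by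
      constructor
      · rintro ⟨⟨y, h⟩, ⟨⟨z, p⟩, hp⟩⟩ ⟨⟨y', h'⟩, ⟨⟨z', p'⟩, hp'⟩⟩ hs
        obtain ⟨rfl, e⟩ := Sigma.mk.inj_iff.1 (congrArg Subtype.val hs)
        obtain ⟨rfl, e⟩ := (SimpleGraph.Walk.cons.injEq ..).mp (eq_of_heq e)
        obtain rfl := eq_of_heq e
        rfl
      · rintro ⟨⟨y, p⟩, hp⟩
        cases p with
        | nil => simp at hp
        | cons h p => exact ⟨⟨⟨_, h⟩, ⟨⟨_, p⟩, by simpa using hp⟩⟩, rfl⟩)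

theorem sum_pathFrom_succ (x : V) (m : ℕ) (F : PathFrom G x (m + 1) → ℂ) :
    ∑ p, F p = ∑ y : G.neighborSet x, ∑ p : PathFrom G y m, F (consEquiv G x m ⟨y, p⟩) := by
  rw [← (consEquiv G x m).sum_comp, Fintype.sum_sigma]

theorem sum_pathFrom_zero (x : V) (F : PathFrom G x 0 → ℂ) :
    ∑ p, F p = F ⟨⟨x, SimpleGraph.Walk.nil⟩, rfl⟩ := by
  have : ∀ p : PathFrom G x 0, p = ⟨⟨x, SimpleGraph.Walk.nil⟩, rfl⟩ := by
    rintro ⟨⟨y, p⟩, hp⟩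
    cases p with
    | nil => rfl
    | cons h p => simp at hp
  exact Fintype.sum_eq_single _ fun p hp => absurd (this p) hp

theorem sum_neighborSet (x : V) (F : V → ℂ) :
    ∑ y : G.neighborSet x, F y = ∑ y ∈ G.neighborFinset x, F y :=
  (Finset.sum_subtype _ (fun y => by simp) F).symm

theorem bumpCount_cons_nil {x y : V} (h : G.Adj x y) :
    bumpCount G (SimpleGraph.Walk.cons h SimpleGraph.Walk.nil) = 0 := by
  simp [bumpCount]

-- In a simple graph an oriented edge is determined by its end points, so the first two edges form a
-- bump exactly when the third vertex is the first one.
open Classical in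
theorem bumpCount_cons_cons {x y z w : V} (h : G.Adj x y) (h' : G.Adj y z) (p : G.Walk z w) :
    bumpCount G (SimpleGraph.Walk.cons h (SimpleGraph.Walk.cons h' p))
      = bumpCount G (SimpleGraph.Walk.cons h' p) + if z = x then 1 else 0 := by
  simp [bumpCount, List.countP_cons, eq_comm]

theorem sum_paths_with_first_edge (t : ℂ) (f : V → ℂ) (m : ℕ) {x y : V} (h : G.Adj x y) :
    ∑ p : PathFrom G y m, t ^ bumpCount G (SimpleGraph.Walk.cons h p.1.2) * f p.1.1
      = dartSum G t f m x y := by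
  classical
  induction m generalizing x y with
  | zero =>
    rw [sum_pathFrom_zero]
    simp [bumpCount_cons_nil, dartSum]
  | succ m ih =>
    rw [sum_pathFrom_succ, dartSum,
      ← sum_neighborSet G y fun z => (if z = x then t else 1) * dartSum G t f m y z]
    refine Finset.sum_congr rfl fun z _ => ?_
    rw [← ih z.2, Finset.mul_sum]
    refine Finset.sum_congr rfl fun p _ => ?_
    change t ^ bumpCount G (SimpleGraph.Walk.cons h (SimpleGraph.Walk.cons z.2 p.1.2)) * f p.1.1 = _
    rw [bumpCount_cons_cons G h ((G.mem_neighborSet _ _).1 z.2) p.1.2]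
    split_ifs <;> ring

theorem pathOp_zero (t : ℂ) : pathOp G t 0 = 1 := by
  ext f x
  change ∑ p : PathFrom G x 0, t ^ bumpCount G p.1.2 * f p.1.1 = f x
  rw [sum_pathFrom_zero]
  simp [bumpCount]

theorem pathOp_succ_apply (t : ℂ) (m : ℕ) (f : V → ℂ) (x : V) :
    pathOp G t (m + 1) f x = ∑ y ∈ G.neighborFinset x, dartSum G t f m x y := by
  change ∑ p : PathFrom G x (m + 1), t ^ bumpCount G p.1.2 * f p.1.1 = _
  rw [sum_pathFrom_succ, ← sum_neighborSet]
  exact Finset.sum_congr rfl fun y _ => sum_paths_with_first_edge G t f m y.2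

theorem adjOp_apply (f : V → ℂ) (x : V) : adjOp G f x = ∑ y ∈ G.neighborFinset x, f y := rfl

theorem pathOp_one (t : ℂ) : pathOp G t 1 = adjOp G := by
  ext f x
  rw [pathOp_succ_apply]
  rfl

/-- Give every continuation from `y` the weight `1`, which yields `C_{m+1}(t) f (y)`, then correct
the single continuation that returns to `x`: it has weight `t = 1 - (1 - t)`. The correction
involves the reversed edge `(y, x)`, which is why a second application closes the recursion. -/
theorem dartSum_succ (t : ℂ) (f : V → ℂ) (m : ℕ) {x y : V} (h : G.Adj x y) :
    dartSum G t f (m + 1) x y = pathOp G t (m + 1) f y - (1 - t) * dartSum G t f m y x := by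
  classical
  rw [dartSum, pathOp_succ_apply, eq_sub_iff_add_eq]
  have hx : x ∈ G.neighborFinset y := by simpa using h.symm
  rw [← Finset.sum_erase_add _ _ hx, ← Finset.sum_erase_add _ (dartSum G t f m y) hx, if_pos rfl]
  have : ∑ z ∈ (G.neighborFinset y).erase x, (if z = x then t else 1) * dartSum G t f m y z
      = ∑ z ∈ (G.neighborFinset y).erase x, dartSum G t f m y z :=
    Finset.sum_congr rfl fun z hz => by rw [if_neg (Finset.ne_of_mem_erase hz), one_mul]
  rw [this]
  ring

theorem pathOp_succ_succ_apply (t : ℂ) (f : V → ℂ) (m : ℕ) (x : V) :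
    pathOp G t (m + 2) f x = adjOp G (pathOp G t (m + 1) f) x
      - (1 - t) * ∑ y ∈ G.neighborFinset x, dartSum G t f m y x := by
  rw [pathOp_succ_apply, adjOp_apply, Finset.mul_sum, ← Finset.sum_sub_distrib]
  exact Finset.sum_congr rfl fun y hy => dartSum_succ G t f m (by simpa using hy)

variable {G} {q : ℕ} (hG : G.IsRegularOfDegree (q + 1))
include hG

theorem degOp_of_regular : degOp G = ((q : ℂ) + 1) • 1 := by
  ext f x
  change (G.degree x : ℂ) * f x = ((q : ℂ) + 1) * f x
  rw [hG x]; push_cast; rfl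

/-- The correction term for length two is a sum of `q + 1` copies of `f x`. For longer paths a
factor `q + t` appears instead, and this mismatch is the source of the `(1 - t)²` terms. -/
theorem pathOp_two (t : ℂ) :
    pathOp G t 2 = adjOp G * adjOp G - ((1 - t) * (q + 1)) • 1 := by
  ext f x
  rw [pathOp_succ_succ_apply, pathOp_one]
  change _ - (1 - t) * ∑ y ∈ G.neighborFinset x, f x = _ - (1 - t) * (q + 1) * f x
  rw [Finset.sum_const, SimpleGraph.card_neighborFinset_eq_degree, hG x]
  simp; ring

/-- Applying `dartSum_succ` again to the reversed edges, the sum over the neighbours is `(q + 1) -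
(1 - t) = q + t` times `C_{m+1}(t) f (x)`. -/
theorem pathOp_add_three (t : ℂ) (m : ℕ) :
    pathOp G t (m + 3) = adjOp G * pathOp G t (m + 2)
      - ((1 - t) * (q + t)) • pathOp G t (m + 1) := by
  ext f x
  rw [pathOp_succ_succ_apply]
  have : ∑ y ∈ G.neighborFinset x, dartSum G t f (m + 1) y x
      = (q + t) * pathOp G t (m + 1) f x := by
    have h1 : ∀ y ∈ G.neighborFinset x, dartSum G t f (m + 1) y x
        = pathOp G t (m + 1) f x - (1 - t) * dartSum G t f m x y := fun y hy =>
      dartSum_succ G t f m (by simpa using ((G.mem_neighborFinset _ _).1 hy).symm)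
    rw [Finset.sum_congr rfl h1, Finset.sum_sub_distrib, ← Finset.mul_sum, ← pathOp_succ_apply,
      Finset.sum_const, SimpleGraph.card_neighborFinset_eq_degree, hG x]
    simp; ring
  rw [this]
  change _ = _ - (1 - t) * (q + t) * pathOp G t (m + 1) f x
  rw [mul_assoc]; rfl

theorem norm_dartSum_le {t : ℂ} (ht : ‖t‖ ≤ 1) {f : V → ℂ} (hf : ∀ x, ‖f x‖ ≤ 1) (m : ℕ)
    (x y : V) : ‖dartSum G t f m x y‖ ≤ ((q : ℝ) + 1) ^ m := by
  classical
  induction m generalizing x y with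
  | zero => simpa [dartSum] using hf y
  | succ m ih =>
    rw [dartSum]
    refine (norm_sum_le_of_le (f := fun z => (if z = x then t else 1) * dartSum G t f m y z)
      _ (n := fun _ => ((q : ℝ) + 1) ^ m) fun z _ => ?_).trans ?_
    · rw [norm_mul]
      refine (mul_le_of_le_one_left (norm_nonneg _) ?_).trans (ih y z)
      split_ifs <;> simp [ht]
    · rw [Finset.sum_const, SimpleGraph.card_neighborFinset_eq_degree, hG y, pow_succ']
      simp

theorem norm_pathOp_le {t : ℂ} (ht : ‖t‖ ≤ 1) {f : V → ℂ} (hf : ∀ x, ‖f x‖ ≤ 1) (m : ℕ)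
    (x : V) : ‖pathOp G t m f x‖ ≤ ((q : ℝ) + 1) ^ m := by
  cases m with
  | zero => simpa [pathOp_zero] using hf x
  | succ m =>
    rw [pathOp_succ_apply]
    refine (norm_sum_le_of_le _ fun z _ => norm_dartSum_le hG ht hf m x z).trans ?_
    rw [Finset.sum_const, SimpleGraph.card_neighborFinset_eq_degree, hG x, pow_succ']
    simp

theorem norm_entry_pathOp_le {t : ℂ} (ht : ‖t‖ ≤ 1) (m : ℕ) (x y : V) :
    ‖entry (pathOp G t m) x y‖ ≤ ((q : ℝ) + 1) ^ m := by
  classical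
  refine norm_pathOp_le hG ht (fun z => ?_) m y
  rw [Pi.single_apply]
  split_ifs <;> simp

end Paths
end Bartholdi

namespace Bartholdi
-- Power sums, complete homogeneous polynomials and the telescoping of `cbcOp`
section Recurrences

section Algebra
variable {R : Type*} [Ring R] [Algebra ℂ R]

/-- The power sums `α ^ m + β ^ m` of two numbers with sum `a` and product `c`. -/
def lucasSeq (c : ℂ) (a : R) : ℕ → R
  | 0 => (2 : ℂ) • 1
  | 1 => a
  | m + 2 => a * lucasSeq c a (m + 1) - c • lucasSeq c a m

/-- The complete homogeneous polynomials of degree `m` in two numbers with sum `a` and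
product `c`. -/
def chebSeq (c : ℂ) (a : R) : ℕ → R
  | 0 => 1
  | 1 => a
  | m + 2 => a * chebSeq c a (m + 1) - c • chebSeq c a m

/-- In terms of roots: the complete homogeneous sum of degree `m + 2` consists of its two pure
powers and of `αβ` times the sum of degree `m`. -/
theorem lucasSeq_add_two (c : ℂ) (a : R) (m : ℕ) :
    lucasSeq c a (m + 2) = chebSeq c a (m + 2) - c • chebSeq c a m := by
  -- The recurrence has order two, so two consecutive instances are carried through the induction.
  suffices H : lucasSeq c a (m + 2) = chebSeq c a (m + 2) - c • chebSeq c a m ∧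
      lucasSeq c a (m + 3) = chebSeq c a (m + 3) - c • chebSeq c a (m + 1) from H.1
  induction m with
  | zero =>
    have h2 : lucasSeq c a 2 = a * a - c • (2 : ℂ) • 1 := rfl
    have h3 : lucasSeq c a 3 = a * lucasSeq c a 2 - c • a := rfl
    have k2 : chebSeq c a 2 = a * a - c • 1 := rfl
    have k3 : chebSeq c a 3 = a * chebSeq c a 2 - c • a := rfl
    have k1 : chebSeq c a 1 = a := rfl
    have k0 : chebSeq c a 0 = 1 := rfl
    simp only [zero_add, h3, k3, h2, k2, k1, k0, mul_sub, mul_smul_comm, mul_one]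
    constructor <;> module
  | succ m ih =>
    refine ⟨ih.2, ?_⟩
    have h : lucasSeq c a (m + 4) = a * lucasSeq c a (m + 3) - c • lucasSeq c a (m + 2) := rfl
    have k : chebSeq c a (m + 4) = a * chebSeq c a (m + 3) - c • chebSeq c a (m + 2) := rfl
    have k' : a * chebSeq c a (m + 1) = chebSeq c a (m + 2) + c • chebSeq c a m :=
      (sub_add_cancel _ _).symm
    change lucasSeq c a (m + 4) = chebSeq c a (m + 4) - c • chebSeq c a (m + 2)
    rw [h, k, ih.1, ih.2, mul_sub, mul_smul_comm, k']
    module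

theorem map_lucasSeq {S : Type*} [Ring S] [Algebra ℂ S] (φ : R →ₐ[ℂ] S) (c : ℂ) (a : R) (m : ℕ) :
    φ (lucasSeq c a m) = lucasSeq c (φ a) m := by
  suffices H : φ (lucasSeq c a m) = lucasSeq c (φ a) m ∧
      φ (lucasSeq c a (m + 1)) = lucasSeq c (φ a) (m + 1) from H.1
  induction m with
  | zero => simp [lucasSeq]
  | succ m ih =>
    refine ⟨ih.2, ?_⟩
    simp only [lucasSeq] at ih ⊢
    rw [map_sub, map_mul, map_smul, ih.1, ih.2]

theorem lucasSeq_eq_pow_add_pow (a b : ℂ) (m : ℕ) :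
    lucasSeq (a * b) (a + b) m = a ^ m + b ^ m := by
  suffices H : lucasSeq (a * b) (a + b) m = a ^ m + b ^ m ∧
      lucasSeq (a * b) (a + b) (m + 1) = a ^ (m + 1) + b ^ (m + 1) from H.1
  induction m with
  | zero => simp [lucasSeq]; norm_num
  | succ m ih =>
    refine ⟨ih.2, ?_⟩
    simp only [lucasSeq] at ih ⊢
    rw [ih.1, ih.2, smul_eq_mul]
    ring

end Algebra

variable {V : Type*} {G : SimpleGraph V} [G.LocallyFinite] {q : ℕ}
  (hG : G.IsRegularOfDegree (q + 1)) (t : ℂ)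
include hG

/-- Both sides satisfy the same second-order recurrence, so only lengths two and three need
checking. The former is `(1-t)(q+1) = c + (1-t)²`. -/
theorem pathOp_add_two (m : ℕ) :
    pathOp G t (m + 2) = chebSeq ((1 - t) * (q + t)) (adjOp G) (m + 2)
      - (1 - t) ^ 2 • chebSeq ((1 - t) * (q + t)) (adjOp G) m := by
  set c : ℂ := (1 - t) * (q + t) with hc
  set A := adjOp G
  suffices H : pathOp G t (m + 2) = chebSeq c A (m + 2) - (1 - t) ^ 2 • chebSeq c A m ∧
      pathOp G t (m + 3) = chebSeq c A (m + 3) - (1 - t) ^ 2 • chebSeq c A (m + 1) from H.1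
  have key : (1 - t) * (q + 1) = c + (1 - t) ^ 2 := by rw [hc]; ring
  have k2 : chebSeq c A 2 = A * A - c • 1 := rfl
  have h2 : pathOp G t 2 = chebSeq c A 2 - (1 - t) ^ 2 • chebSeq c A 0 := by
    rw [pathOp_two hG, key, k2, chebSeq, add_smul]
    abel
  induction m with
  | zero =>
    refine ⟨h2, ?_⟩
    rw [pathOp_add_three hG, h2, ← hc, zero_add, pathOp_one]
    change A * _ - c • A = (A * chebSeq c A 2 - c • A) - (1 - t) ^ 2 • A
    rw [mul_sub, mul_smul_comm, chebSeq, mul_one]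
    abel
  | succ m ih =>
    refine ⟨ih.2, ?_⟩
    have k : chebSeq c A (m + 4) = A * chebSeq c A (m + 3) - c • chebSeq c A (m + 2) := rfl
    have k' : A * chebSeq c A (m + 1) = chebSeq c A (m + 2) + c • chebSeq c A m :=
      (sub_add_cancel _ _).symm
    change pathOp G t (m + 4) = chebSeq c A (m + 4) - (1 - t) ^ 2 • chebSeq c A (m + 2)
    rw [pathOp_add_three hG, ← hc, k, ih.1, ih.2, mul_sub, mul_smul_comm, k']
    module

/-- Each summand is a difference of consecutive terms of `(1-t)^(2j+2) U`, by `pathOp_add_two`. The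
parameter `m` is the degree at which the telescoping stops. -/
theorem sum_pow_smul_pathOp (m n : ℕ) :
    ∑ j ∈ Finset.Icc 1 n, (1 - t) ^ (2 * j) • pathOp G t (2 * n + m + 2 - 2 * j)
      = (1 - t) ^ 2 • chebSeq ((1 - t) * (q + t)) (adjOp G) (2 * n + m)
        - (1 - t) ^ (2 * n + 2) • chebSeq ((1 - t) * (q + t)) (adjOp G) m := by
  set c : ℂ := (1 - t) * (q + t) with hc
  induction n generalizing m with
  | zero => simp
  | succ n ih =>
    have h1 := ih (m + 2)
    rw [Finset.sum_Icc_succ_top (by omega)]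
    have e : 2 * n + (m + 2) + 2 = 2 * (n + 1) + m + 2 := by ring
    have e' : 2 * n + (m + 2) = 2 * (n + 1) + m := by ring
    have e2 : 2 * (n + 1) + m + 2 - 2 * (n + 1) = m + 2 := by omega
    rw [e, e'] at h1
    rw [h1, e2, pathOp_add_two hG, ← hc]
    module

omit hG in
theorem ceil_half_sub_one (m : ℕ) : ⌈(m : ℚ) / 2⌉₊ - 1 = (m - 1) / 2 := by
  rcases Nat.even_or_odd' m with ⟨k, rfl | rfl⟩
  · have : (((2 * k : ℕ) : ℚ) / 2) = (k : ℕ) := by push_cast; ring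
    rw [this, Nat.ceil_natCast]
    omega
  · have : ⌈((2 * k + 1 : ℕ) : ℚ) / 2⌉₊ = k + 1 := by
      rw [Nat.ceil_eq_iff (by omega)]
      push_cast
      constructor <;> linarith
    rw [this]
    omega

theorem sum_pow_smul_pathOp_ceil (m : ℕ) :
    ∑ j ∈ Finset.Icc 1 (⌈((m + 3 : ℕ) : ℚ) / 2⌉₊ - 1),
        (1 - t) ^ (2 * j) • pathOp G t (m + 3 - 2 * j)
      = (1 - t) ^ 2 • chebSeq ((1 - t) * (q + t)) (adjOp G) (m + 1)
        - ((if Even (m + 3) then 1 else 0) * (1 - t) ^ (m + 3)) • 1 := by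
  rw [ceil_half_sub_one]
  rcases Nat.even_or_odd' m with ⟨k, rfl | rfl⟩
  · have e : (2 * k + 3 - 1) / 2 = k + 1 := by omega
    have e2 : 2 * k + 3 - 2 * (k + 1) = 1 := by omega
    have h := sum_pow_smul_pathOp hG t 1 k
    have hodd : ¬ Even (2 * k + 3) := by rw [Nat.not_even_iff_odd]; exact ⟨k + 1, by ring⟩
    -- For odd length the last path operator is `C_1 = A = U_1`, outside the range of
    -- `pathOp_add_two`; it cancels the telescoping remainder. For even length the remainder is a
    -- multiple of `U_0 = 1` and survives.
    rw [e, Finset.sum_Icc_succ_top (by omega), h, e2, pathOp_one, if_neg hodd]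
    change _ - (1 - t) ^ (2 * k + 2) • adjOp G + _ = _
    module
  · have e : (2 * k + 1 + 3 - 1) / 2 = k + 1 := by omega
    have h := sum_pow_smul_pathOp hG t 0 (k + 1)
    have heven : Even (2 * k + 1 + 3) := ⟨k + 2, by ring⟩
    rw [e, if_pos heven]
    have e1 : 2 * (k + 1) + 0 + 2 = 2 * k + 1 + 3 := by ring
    rw [e1] at h
    rw [h, one_mul]
    rfl

/-- The coefficient of `U_{m+1}` is `-(1-t)² - (1-t)(q+2t-1) = -c`, which turns `U_{m+3}` into the
power sum. For even length the scalars combine as `(q+2t-1) - t(q+1) = (q-1)(1-t)`, times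
`(1-t)^(m+2)`. -/
theorem cbcOp_add_three (ht : 1 - t ≠ 0) (m : ℕ) :
    cbcOp G t (m + 3) = lucasSeq ((1 - t) * (q + t)) (adjOp G) (m + 3)
      + (1 - t) • Rop G t (m + 3)
      + ((if Even (m + 3) then 1 else 0) * ((q : ℂ) - 1) * (1 - t) ^ (m + 3)) • 1 := by
  have h1 : pathOp G t (m + 3) = _ := pathOp_add_two hG t (m + 1)
  have h2 : lucasSeq ((1 - t) * (q + t)) (adjOp G) (m + 3) = _ := lucasSeq_add_two _ _ (m + 1)
  have h3 : (1 - t)⁻¹ • (Qop G t - (1 - t) • 1)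
      = ((1 - t)⁻¹ * (q + t - (1 - t))) • (1 : Module.End ℂ (V → ℂ)) := by
    rw [Qop, degOp_of_regular hG, mul_smul]
    congr 1
    module
  rw [cbcOp, sum_pow_smul_pathOp_ceil hG, h3, h1, h2, degOp_of_regular hG, smul_mul_assoc, one_mul]
  have hp : m + 3 - 1 = m + 2 := rfl
  rw [hp]
  match_scalars <;> field_simp <;> ring

theorem cbcOp_two :
    cbcOp G t 2 = lucasSeq ((1 - t) * (q + t)) (adjOp G) 2
      + (1 - t) • (t • degOp G - pathOp G t 2)
      + (((q : ℂ) - 1) * (1 - t) ^ 2) • 1 := by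
  have h2 : lucasSeq ((1 - t) * (q + t)) (adjOp G) 2
    = adjOp G * adjOp G - ((1 - t) * (q + t)) • (2 : ℂ) • 1 := rfl
  rw [cbcOp, h2, pathOp_two hG, degOp_of_regular hG]
  module

omit hG in
theorem cbcOp_one (c : ℂ) : cbcOp G t 1 = lucasSeq c (adjOp G) 1 := pathOp_one G t

end Recurrences
end Bartholdi

namespace Bartholdi
open MeasureTheory Filter Topology
open scoped InnerProductSpace
-- Termwise integration against the spectral measure
section SpectralIntegral
universe u₁ u₂
variable {X : Type u₁} [MetricSpace X] [CompactSpace X] [MeasurableSpace X] [BorelSpace X]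
  {H : Type u₂} [NormedAddCommGroup H] [InnerProductSpace ℂ H] [CompleteSpace H]
  (Φ : C(X, ℝ) →⋆ₐ[ℝ] (H →L[ℂ] H))

/-- Integrals against `⟨E v, w⟩` are finite complex combinations of integrals against finite
positive measures. -/
theorem exists_finite_measures (v w : H) : ∃ (c : Fin 4 → ℂ) (p : Fin 4 → Measure X),
    (∀ i, IsFiniteMeasure (p i)) ∧ ∀ f : X → ℂ, (∀ i, Integrable f (p i)) →
      ((constructedPVM Φ).complexMeasure v w).Integrable f ∧
      ((constructedPVM Φ).complexMeasure v w).integral f (ContinuousLinearMap.mul ℝ ℂ)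
        = ∑ i, c i * ∫ x, f x ∂(p i) := by
  refine ⟨![1 / 4, -1 / 4, Complex.I / 4, -Complex.I / 4], fun i => vecMeasure Φ
    (![v + w, v - w, v + Complex.I • w, v - Complex.I • w] i), fun i => inferInstance,
    fun f hf => integral_eq_sum _ _ _ _ (fun B hB => ?_) hf⟩
  rw [ProjectionValuedMeasure.complexMeasure_apply _ _ _ hB, polar]
  simp only [← projMap_inner_self Φ hB]
  rfl

theorem continuous_integrable (p : Measure X) [IsFiniteMeasure p] {f : X → ℂ}
    (hf : Continuous f) : Integrable f p :=
  (BoundedContinuousFunction.mkOfCompact ⟨f, hf⟩).integrable p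

/-- A uniformly dominated series of continuous functions can be integrated term by term. -/
theorem hasSum_integral_complexMeasure (v w : H) {f : ℕ → X → ℂ} {g : X → ℂ} {b : ℕ → ℝ}
    (hf : ∀ n, Continuous (f n)) (hb : ∀ n x, ‖f n x‖ ≤ b n) (hs : Summable b)
    (hg : ∀ x, HasSum (fun n => f n x) (g x)) :
    ((constructedPVM Φ).complexMeasure v w).Integrable g ∧
    HasSum (fun n => ((constructedPVM Φ).complexMeasure v w).integral (f n)
        (ContinuousLinearMap.mul ℝ ℂ))
      (((constructedPVM Φ).complexMeasure v w).integral g (ContinuousLinearMap.mul ℝ ℂ)) := by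
  obtain ⟨c, p, hp, h⟩ := exists_finite_measures Φ v w
  have hgc : Continuous g := by
    -- The limit is continuous by uniform convergence, hence integrable for finite measures on a
    -- compact space.
    have : g = fun x => ∑' n, f n x := funext fun x => (hg x).tsum_eq.symm
    rw [this]
    exact continuous_tsum hf hs hb
  refine ⟨(h g fun i => continuous_integrable _ hgc).1, ?_⟩
  rw [(h g fun i => continuous_integrable _ hgc).2]
  simp only [fun n => (h (f n) fun i => continuous_integrable _ (hf n)).2]
  refine hasSum_sum fun i _ => HasSum.mul_left _ ?_
  refine hasSum_integral_of_dominated_convergence (fun n _ => b n)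
    (fun n => (hf n).aestronglyMeasurable) (fun n => ae_of_all _ (hb n)) (ae_of_all _ fun _ => hs)
    (integrable_const _) (ae_of_all _ hg)

end SpectralIntegral

section PolynomialIntegral
universe u₂
variable {H : Type u₂} [NormedAddCommGroup H] [InnerProductSpace ℂ H] [CompleteSpace H]

open Polynomial in
-- The real functional calculus gives the monomials; complex coefficients follow by linearity,
-- obtained from the positive measures of `exists_finite_measures`.
theorem integral_polynomial_spectralMeasure (T : H →L[ℂ] H) (hT : IsSelfAdjoint T) (v w : H)
    (P : ℂ[X]) :
    ((spectralMeasure T hT).complexMeasure v w).integral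
        (fun l : spectrum ℝ T => P.eval ((l : ℝ) : ℂ)) (ContinuousLinearMap.mul ℝ ℂ)
      = ⟪w, aeval T P v⟫_ℂ := by
  obtain ⟨c, p, hp, h⟩ := exists_finite_measures (cfcHom (R := ℝ) hT) v w
  have hc : ∀ P : ℂ[X], Continuous fun l : spectrum ℝ T => P.eval ((l : ℝ) : ℂ) := fun P => by
    fun_prop
  have key : ∀ P : ℂ[X], ((spectralMeasure T hT).complexMeasure v w).integral
        (fun l : spectrum ℝ T => P.eval ((l : ℝ) : ℂ)) (ContinuousLinearMap.mul ℝ ℂ)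
      = ∑ i, c i * ∫ l : spectrum ℝ T, P.eval ((l : ℝ) : ℂ) ∂(p i) := fun P =>
    (h _ fun i => continuous_integrable _ (hc P)).2
  rw [key]
  induction P using Polynomial.induction_on' with
  | add P Q hP hQ =>
    rw [map_add, add_apply, inner_add_right, ← hP, ← hQ, ← Finset.sum_add_distrib]
    refine Finset.sum_congr rfl fun i _ => ?_
    rw [← mul_add, ← integral_add (continuous_integrable _ (hc P)) (continuous_integrable _ (hc Q))]
    simp
  | monomial n a =>
    have h1 := integral_constructedPVM (cfcHom (R := ℝ) hT)
      (((ContinuousMap.id ℝ).restrict (spectrum ℝ T)) ^ n) v w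
    rw [map_pow, cfcHom_id] at h1
    have h2 := key (X ^ n)
    have h3 : (fun l : spectrum ℝ T => ((X ^ n : ℂ[X]).eval ((l : ℝ) : ℂ)))
        = fun l => (((((ContinuousMap.id ℝ).restrict (spectrum ℝ T)) ^ n : C(_, ℝ)) l : ℝ) : ℂ) := by
      ext l; simp
    rw [spectralMeasure, h3, h1] at h2
    rw [aeval_monomial, ← Algebra.smul_def, smul_apply, inner_smul_right, h2, Finset.mul_sum]
    refine Finset.sum_congr rfl fun i _ => ?_
    simp only [eval_monomial]
    rw [integral_const_mul, mul_left_comm]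
    simp

theorem hasSum_integral_spectralMeasure (T : H →L[ℂ] H) (hT : IsSelfAdjoint T) (v w : H)
    {f : ℕ → spectrum ℝ T → ℂ} {g : spectrum ℝ T → ℂ} {b : ℕ → ℝ}
    (hf : ∀ n, Continuous (f n)) (hb : ∀ n l, ‖f n l‖ ≤ b n) (hs : Summable b)
    (hg : ∀ l, HasSum (fun n => f n l) (g l)) :
    ((spectralMeasure T hT).complexMeasure v w).Integrable g ∧
    HasSum (fun n => ((spectralMeasure T hT).complexMeasure v w).integral (f n)
        (ContinuousLinearMap.mul ℝ ℂ))
      (((spectralMeasure T hT).complexMeasure v w).integral g (ContinuousLinearMap.mul ℝ ℂ)) :=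
  hasSum_integral_complexMeasure (cfcHom (R := ℝ) hT) v w hf hb hs hg

end PolynomialIntegral

/-! ### The spectrum of the Laplacian and its polynomials -/

section LaplacianSpectrum
variable {V : Type*} (G : SimpleGraph V) [G.LocallyFinite] {q : ℕ}

/-- The operator is the adjacency operator on `ℓ²`. Cauchy–Schwarz at each vertex costs one factor
`q + 1`, and counting each vertex once per neighbour costs another. -/
theorem norm_degree_sub_laplacian_le (hG : G.IsRegularOfDegree (q + 1)) (h : BoundedDegree G) :
    ‖((q : ℝ) + 1) • (1 : L2 V →L[ℂ] L2 V) - laplacian G h‖ ≤ q + 1 := by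
  refine ContinuousLinearMap.opNorm_le_bound _ (by positivity) fun f => ?_
  set g : L2 V := (((q : ℝ) + 1) • (1 : L2 V →L[ℂ] L2 V) - laplacian G h) f with hg
  have hgx : ∀ x, g x = ∑ y ∈ G.neighborFinset x, f y := fun x => by
    have e : g x = ((q : ℝ) + 1) • f x - laplacian G h f x := rfl
    rw [e, laplacian_apply]
    change _ - ((G.degree x : ℂ) * f x - ∑ y ∈ G.neighborFinset x, f y) = _
    rw [hG x, Complex.real_smul]
    push_cast
    ring
  have h1 : ∀ x, ‖g x‖ₑ ^ 2 ≤ (q + 1 : ℕ) * ∑ y ∈ G.neighborFinset x, ‖f y‖ₑ ^ 2 := fun x => by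
    have h1 : ‖g x‖ ^ 2 ≤ (q + 1 : ℕ) * ∑ y ∈ G.neighborFinset x, ‖f y‖ ^ 2 := by
      rw [hgx, ← hG x, ← SimpleGraph.card_neighborFinset_eq_degree]
      refine le_trans ?_ sq_sum_le_card_mul_sum_sq
      gcongr
      exact norm_sum_le _ _
    have h2 := ENNReal.ofReal_le_ofReal h1
    rw [ENNReal.ofReal_pow (norm_nonneg _), ENNReal.ofReal_mul (by positivity),
      ENNReal.ofReal_sum_of_nonneg (fun _ _ => by positivity), ENNReal.ofReal_natCast] at h2
    simpa only [ENNReal.ofReal_pow (norm_nonneg _), ofReal_norm] using h2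
  have h2 : ‖g‖ₑ ^ 2 ≤ (((q + 1 : ℕ) : ENNReal) * ‖f‖ₑ) ^ 2 := by
    rw [enorm_sq_L2, mul_pow, enorm_sq_L2]
    refine (ENNReal.tsum_le_tsum h1).trans ?_
    rw [ENNReal.tsum_mul_left, pow_two, mul_assoc]
    gcongr
    exact sum_sq_adj G (q + 1) (fun x => (hG x).le) _
  have h3 := (ENNReal.pow_le_pow_left_iff (by norm_num : (2:ℕ) ≠ 0)).1 h2
  have h4 := ENNReal.toReal_mono (by finiteness) h3
  rw [ENNReal.toReal_mul, ENNReal.toReal_natCast, toReal_enorm, toReal_enorm] at h4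
  exact_mod_cast h4

theorem abs_degree_sub_le_of_mem_spectrum (hG : G.IsRegularOfDegree (q + 1))
    (h : BoundedDegree G) {l : ℝ} (hl : l ∈ spectrum ℝ (laplacian G h)) :
    |(q : ℝ) + 1 - l| ≤ q + 1 := by
  have h1 : (q : ℝ) + 1 - l ∈ spectrum ℝ (((q : ℝ) + 1) • (1 : L2 V →L[ℂ] L2 V)
      - laplacian G h) := by
    rw [← Algebra.algebraMap_eq_smul_one, ← spectrum.singleton_sub_eq]
    exact Set.sub_mem_sub rfl hl
  have h2 := spectrum.norm_le_norm_mul_of_mem h1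
  refine h2.trans ?_
  have h3 := norm_degree_sub_laplacian_le G hG h
  have h4 : ‖(1 : L2 V →L[ℂ] L2 V)‖ ≤ 1 := ContinuousLinearMap.norm_id_le
  calc _ ≤ ((q : ℝ) + 1) * 1 := by gcongr
    _ = _ := mul_one _

open Polynomial in
theorem aeval_laplacian_apply (h : BoundedDegree G) (P : ℂ[X]) (f : L2 V) :
    (aeval (laplacian G h) P f : L2 V) = aeval (lapOp G) P (f : V → ℂ) := by
  induction P using Polynomial.induction_on generalizing f with
  | C a => rw [aeval_C, aeval_C]; rfl
  | add P Q hP hQ =>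
    rw [map_add, map_add, LinearMap.add_apply, ← hP, ← hQ]; rfl
  | monomial n a ih =>
    rw [pow_succ, ← mul_assoc, map_mul, map_mul _ _ X, aeval_X, aeval_X]
    exact ih (laplacian G h f)

open Polynomial in
-- The bridge from the spectral measure on `ℓ²` to matrix coefficients of operators on all
-- functions.
theorem integral_polynomial_laplacianMeasure (h : BoundedDegree G) (x₀ x : V) (P : ℂ[X]) :
    (laplacianMeasure G h x₀ x).integral (fun l => P.eval ((l : ℝ) : ℂ))
        (ContinuousLinearMap.mul ℝ ℂ) = entry (aeval (lapOp G) P) x₀ x := by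
  classical
  refine (integral_polynomial_spectralMeasure (laplacian G h) (isSelfAdjoint_laplacian G h)
    (delta x₀) (delta x) P).trans ?_
  rw [delta_inner, aeval_laplacian_apply, entry]
  congr 1

end LaplacianSpectrum
end Bartholdi

namespace Bartholdi
-- Logarithms, bounds by `alpha`, and the coefficients of the zeta function
section Estimates
open MeasureTheory

/-- The logarithm of a quadratic polynomial with small inverse roots. -/
theorem hasSum_neg_log_quadratic {a b u : ℂ} (ha : ‖a * u‖ < 1) (hb : ‖b * u‖ < 1) :
    HasSum (fun n : ℕ => (a ^ (n + 1) + b ^ (n + 1)) / (n + 1 : ℂ) * u ^ (n + 1))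
      (-Complex.log (1 - (a + b) * u + a * b * u ^ 2)) := by
  have h1 : ∀ z : ℂ, ‖z‖ < 1 → 0 < (1 - z).re := fun z hz => by
    have := (Complex.abs_re_le_norm z).trans_lt hz
    rw [abs_lt] at this
    simp only [Complex.sub_re, Complex.one_re]
    linarith
  have h0 : ∀ z : ℂ, ‖z‖ < 1 → 1 - z ≠ 0 := fun z hz h => by
    have := h1 z hz
    rw [h] at this
    simp at this
  have harg : ∀ z : ℂ, ‖z‖ < 1 → |(1 - z).arg| < Real.pi / 2 := fun z hz =>
    Complex.abs_arg_lt_pi_div_two_iff.2 (Or.inl (h1 z hz))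
  have hs : ∀ z : ℂ, ‖z‖ < 1 →
      HasSum (fun n : ℕ => z ^ (n + 1) / (n + 1 : ℂ)) (-Complex.log (1 - z)) := fun z hz => by
    have := (hasSum_nat_add_iff' 1).2 (Complex.hasSum_taylorSeries_neg_log hz)
    simpa using this
  have hprod : 1 - (a + b) * u + a * b * u ^ 2 = (1 - a * u) * (1 - b * u) := by ring
  have hA := abs_lt.1 (harg _ ha)
  have hB := abs_lt.1 (harg _ hb)
  -- Both factors have positive real part, so their arguments add up to less than `π` in modulus and
  -- the principal logarithm is additive.
  rw [hprod, (Complex.log_mul_eq_add_log_iff (h0 _ ha) (h0 _ hb)).2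
    ⟨by linarith [hA.1, hB.1], by linarith [hA.2, hB.2]⟩, neg_add]
  convert (hs _ ha).add (hs _ hb) using 1
  ext n
  ring

theorem exists_add_eq_mul_eq (a c : ℂ) : ∃ x y : ℂ, x + y = a ∧ x * y = c := by
  obtain ⟨s, hs⟩ := IsAlgClosed.exists_pow_nat_eq (a ^ 2 - 4 * c) two_pos
  refine ⟨(a + s) / 2, (a - s) / 2, by ring, ?_⟩
  linear_combination (-1 / 4 : ℂ) * hs

variable {V : Type*} {G : SimpleGraph V} [G.LocallyFinite] {q : ℕ}

theorem maxDegree_of_regular [Nonempty V] (hG : G.IsRegularOfDegree (q + 1)) :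
    maxDegree G = q + 1 := by
  rw [maxDegree, funext hG, ciSup_const]

theorem alpha_sq [Nonempty V] (hG : G.IsRegularOfDegree (q + 1)) (t : ℂ) :
    alpha G t ^ 2 = (q + 1) * alpha G t + (‖t‖ + 1) * (q + 1) := by
  rw [alpha, maxDegree_of_regular hG]
  push_cast
  have := Real.sq_sqrt (show (0 : ℝ) ≤ ((q : ℝ) + 1) ^ 2 + 4 * (‖t‖ + 1) * (q + 1) by positivity)
  linear_combination this / 4

theorem degree_le_alpha [Nonempty V] (hG : G.IsRegularOfDegree (q + 1)) (t : ℂ) :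
    (q : ℝ) + 1 ≤ alpha G t := by
  rw [alpha, maxDegree_of_regular hG]
  push_cast
  have : (q : ℝ) + 1 ≤ √(((q : ℝ) + 1) ^ 2 + 4 * (‖t‖ + 1) * (q + 1)) :=
    Real.le_sqrt_of_sq_le (by linarith [show (0 : ℝ) ≤ 4 * (‖t‖ + 1) * (q + 1) by positivity])
  linarith

/-- Otherwise `α² = (q+1)(α + |t| + 1) > 2α`, so `α > 2`, contradicting `α < |t| + 1 < 2`. -/
theorem norm_add_one_le_alpha [Nonempty V] (hG : G.IsRegularOfDegree (q + 1)) {t : ℂ}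
    (ht : ‖t‖ < 1) : ‖t‖ + 1 ≤ alpha G t := by
  by_contra! h
  have h1 := alpha_sq hG t
  have h2 := degree_le_alpha hG t
  have h3 : (0 : ℝ) ≤ q := by positivity
  have h4 := norm_nonneg t
  nlinarith [mul_nonneg h3 (show 0 ≤ alpha G t by linarith), mul_nonneg h3 h4]

/-- The real number `|z|` satisfies the inequality `s² ≤ (q+1) s + (|t|+1)(q+1)`, which fails beyond
the positive root `alpha`. -/
theorem norm_le_alpha_of_root [Nonempty V] (hG : G.IsRegularOfDegree (q + 1)) {t a c z : ℂ}
    (ha : ‖a‖ ≤ q + 1) (hc : ‖c‖ ≤ (‖t‖ + 1) * (q + 1)) (hz : z ^ 2 = a * z - c) :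
    ‖z‖ ≤ alpha G t := by
  have h1 := alpha_sq hG t
  have h2 := degree_le_alpha hG t
  have h3 : ‖z‖ ^ 2 ≤ (q + 1) * ‖z‖ + (‖t‖ + 1) * (q + 1) := by
    rw [← norm_pow, hz]
    refine (norm_sub_le _ _).trans ?_
    rw [norm_mul]
    gcongr
  by_contra! h
  have h4 : (0 : ℝ) ≤ q := by positivity
  nlinarith [mul_pos (sub_pos.2 h) (show 0 < ‖z‖ + alpha G t - (q + 1) by linarith)]

theorem exists_roots [Nonempty V] (hG : G.IsRegularOfDegree (q + 1)) {t a c : ℂ}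
    (ha : ‖a‖ ≤ q + 1) (hc : ‖c‖ ≤ (‖t‖ + 1) * (q + 1)) :
    ∃ x y : ℂ, x + y = a ∧ x * y = c ∧ ‖x‖ ≤ alpha G t ∧ ‖y‖ ≤ alpha G t := by
  obtain ⟨x, y, rfl, rfl⟩ := exists_add_eq_mul_eq a c
  exact ⟨x, y, rfl, rfl, norm_le_alpha_of_root hG ha hc (by ring),
    norm_le_alpha_of_root hG ha hc (by ring)⟩

theorem norm_lapOp_le (hG : G.IsRegularOfDegree (q + 1)) {f : V → ℂ} {b : ℝ}
    (hf : ∀ x, ‖f x‖ ≤ b) (x : V) : ‖lapOp G f x‖ ≤ 2 * (q + 1) * b := by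
  have e : lapOp G f x = G.degree x * f x - ∑ y ∈ G.neighborFinset x, f y := rfl
  rw [e]
  refine (norm_sub_le _ _).trans ?_
  have h1 := norm_sum_le_of_le (G.neighborFinset x) fun y _ => hf y
  rw [Finset.sum_const, SimpleGraph.card_neighborFinset_eq_degree, nsmul_eq_mul, hG x] at h1
  have h2 : ‖(G.degree x : ℂ) * f x‖ ≤ ((q + 1 : ℕ) : ℝ) * b := by
    rw [norm_mul, Complex.norm_natCast, hG x]
    exact mul_le_mul_of_nonneg_left (hf x) (by positivity)
  push_cast at h1 h2
  linarith

/-- All of `|1-t|`, `|1-t²|^(1/2)` and `q + 1` are at most `alpha`. The exponents add up to `m - 2`,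
and there are at most `m²` terms. -/
theorem norm_Rfun_le (hG : G.IsRegularOfDegree (q + 1)) {t : ℂ} (ht : ‖t‖ < 1) (m : ℕ) (x : V) :
    ‖Rfun G t m x‖ ≤ 2 * (q + 1) * (m ^ 2 * alpha G t ^ m) := by
  have : Nonempty V := ⟨x⟩
  have hK := degree_le_alpha hG t
  have hK' := norm_add_one_le_alpha hG ht
  set K := alpha G t with hKdef
  have hK1 : 1 ≤ K := le_trans (by linarith [norm_nonneg t]) hK'
  have hs : ‖1 - t‖ ≤ K := (norm_sub_le _ _).trans (by rw [norm_one]; linarith)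
  have hs2 : ‖1 - t ^ 2‖ ≤ K ^ 2 := by
    refine (norm_sub_le _ _).trans ?_
    rw [norm_one, norm_pow]
    nlinarith [norm_nonneg t]
  have hterm : ∀ j ∈ Finset.Icc 1 ((m - 1) / 2), ∀ i ∈ Finset.Icc 1 j,
      ‖(1 - t) ^ (2 * (j - i)) * (1 - t ^ 2) ^ (i - 1) *
        lapOp G (fun y => entry (pathOp G t (m - 2 * j)) y y) x‖ ≤ 2 * (q + 1) * K ^ m := by
    intro j hj i hi
    rw [Finset.mem_Icc] at hj hi
    rw [norm_mul, norm_mul, norm_pow, norm_pow]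
    calc _ ≤ K ^ (2 * (j - i)) * (K ^ 2) ^ (i - 1) * (2 * (q + 1) * K ^ (m - 2 * j)) := by
          gcongr
          exact norm_lapOp_le hG (fun y => (norm_entry_pathOp_le hG ht.le _ y y).trans
            (by gcongr)) x
      _ = 2 * (q + 1) * K ^ (2 * (j - i) + 2 * (i - 1) + (m - 2 * j)) := by
          rw [pow_add, pow_add, pow_mul K 2 (i - 1)]; ring
      _ ≤ _ := by
          gcongr
          omega
  rw [Rfun, ceil_half_sub_one]
  have h1 : ∀ j ∈ Finset.Icc 1 ((m - 1) / 2), ‖∑ i ∈ Finset.Icc 1 j,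
      (1 - t) ^ (2 * (j - i)) * (1 - t ^ 2) ^ (i - 1) *
        lapOp G (fun y => entry (pathOp G t (m - 2 * j)) y y) x‖
      ≤ m * (2 * (q + 1) * K ^ m) := fun j hj => by
    refine (norm_sum_le_of_le _ (hterm j hj)).trans ?_
    rw [Finset.sum_const, Nat.card_Icc, nsmul_eq_mul]
    rw [Finset.mem_Icc] at hj
    gcongr
    omega
  refine (norm_sum_le_of_le _ h1).trans ?_
  rw [Finset.sum_const, Nat.card_Icc, nsmul_eq_mul]
  calc _ ≤ (m : ℝ) * (m * (2 * (q + 1) * K ^ m)) := by gcongr; omega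
    _ = _ := by ring

theorem entry_add (B C : Module.End ℂ (V → ℂ)) (x y : V) :
    entry (B + C) x y = entry B x y + entry C x y := rfl

theorem entry_smul (a : ℂ) (B : Module.End ℂ (V → ℂ)) (x y : V) :
    entry (a • B) x y = a * entry B x y := rfl

open Classical in
theorem entry_one (x y : V) :
    entry (1 : Module.End ℂ (V → ℂ)) x y = if y = x then 1 else 0 := by
  rw [entry, Module.End.one_apply, Pi.single_apply]

theorem norm_entry_Rop_le (t : ℂ) (m : ℕ) (x y : V) :
    ‖entry (Rop G t m) x y‖ ≤ ‖Rfun G t m y‖ := by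
  classical
  have : entry (Rop G t m) x y = Rfun G t m y * if y = x then 1 else 0 := by
    rw [← entry_one x y]; rfl
  rw [this, norm_mul]
  refine mul_le_of_le_one_right (norm_nonneg _) ?_
  split_ifs <;> simp

theorem Rop_eq_zero (t : ℂ) {m : ℕ} (hm : m ≤ 2) : Rop G t m = 0 := by
  ext f x
  have : (m - 1) / 2 = 0 := by omega
  change Rfun G t m x * f x = 0
  simp [Rfun, ceil_half_sub_one, this]

theorem summable_Rop (hG : G.IsRegularOfDegree (q + 1)) {t u : ℂ} (ht : ‖t‖ < 1)
    (hu : alpha G t * ‖u‖ < 1) (x₀ x : V) :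
    Summable (fun m : ℕ => (1 - t) * entry (Rop G t (m + 3)) x₀ x / (m + 3 : ℂ) * u ^ (m + 3)) := by
  have : Nonempty V := ⟨x⟩
  have hK := degree_le_alpha hG t
  have hK0 : 0 ≤ alpha G t := le_trans (by positivity) hK
  have hr : ‖alpha G t * ‖u‖‖ < 1 := by
    rwa [Real.norm_of_nonneg (mul_nonneg hK0 (norm_nonneg _))]
  have hsum := (summable_pow_mul_geometric_of_norm_lt_one 2 hr).mul_left (‖1 - t‖ * (2 * (q + 1)))
  refine Summable.of_norm_bounded ((summable_nat_add_iff 3).2 hsum) fun m => ?_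
  rw [norm_mul, norm_div, norm_mul, norm_pow]
  have h3 : 1 ≤ ‖(m + 3 : ℂ)‖ := by
    have : (m + 3 : ℂ) = ((m + 3 : ℕ) : ℂ) := by push_cast; rfl
    rw [this, Complex.norm_natCast]
    push_cast
    linarith [show (0 : ℝ) ≤ m by positivity]
  calc _ ≤ ‖1 - t‖ * (2 * (q + 1) * ((m + 3 : ℕ) ^ 2 * alpha G t ^ (m + 3))) * ‖u‖ ^ (m + 3) := by
        gcongr
        refine (div_le_self (by positivity) h3).trans ?_
        gcongr
        exact (norm_entry_Rop_le t _ x₀ x).trans (norm_Rfun_le hG ht _ x)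
    _ = _ := by rw [mul_pow]; ring

theorem lapOp_regular (hG : G.IsRegularOfDegree (q + 1)) :
    algebraMap ℂ _ ((q : ℂ) + 1) - lapOp G = adjOp G := by
  rw [lapOp, degOp_of_regular hG, Algebra.algebraMap_eq_smul_one]
  abel

open Polynomial in
/-- The logarithm of the determinant factor, expanded in powers of `u`. -/
theorem hasSum_lucasSeq (hG : G.IsRegularOfDegree (q + 1)) (h : BoundedDegree G) {t u : ℂ}
    (ht : ‖t‖ < 1) (hu : alpha G t * ‖u‖ < 1) (x₀ x : V) :
    (laplacianMeasure G h x₀ x).Integrable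
      (fun l => -Complex.log (1 - ((q : ℂ) + 1 - ((l : ℝ) : ℂ)) * u + (1 - t) * (q + t) * u ^ 2)) ∧
    HasSum (fun m : ℕ => entry (lucasSeq ((1 - t) * (q + t)) (adjOp G) (m + 1)) x₀ x
        / (m + 1 : ℂ) * u ^ (m + 1))
      ((laplacianMeasure G h x₀ x).integral
        (fun l => -Complex.log
          (1 - ((q : ℂ) + 1 - ((l : ℝ) : ℂ)) * u + (1 - t) * (q + t) * u ^ 2))
        (ContinuousLinearMap.mul ℝ ℂ)) := by
  have : Nonempty V := ⟨x⟩
  have hK := degree_le_alpha hG t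
  have hK0 : 0 ≤ alpha G t := le_trans (by positivity) hK
  set c : ℂ := (1 - t) * (q + t) with hcdef
  have hc : ‖c‖ ≤ (‖t‖ + 1) * (q + 1) := by
    rw [hcdef, norm_mul]
    gcongr
    · exact (norm_sub_le _ _).trans (by rw [norm_one, add_comm])
    · exact (norm_add_le _ _).trans (by rw [Complex.norm_natCast]; gcongr)
  -- A single polynomial in `λ`: evaluated at a spectral point it is a term of the logarithmic
  -- series, and evaluated at the Laplacian it is a term of the operator series.
  set P : ℕ → ℂ[X] := fun n => C (u ^ (n + 1) / (n + 1 : ℂ)) *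
    lucasSeq c (algebraMap ℂ ℂ[X] ((q : ℂ) + 1) - X) (n + 1) with hP
  have hPeval : ∀ n (l : ℂ), (P n).eval l
      = lucasSeq c ((q : ℂ) + 1 - l) (n + 1) / (n + 1 : ℂ) * u ^ (n + 1) := fun n l => by
    have := map_lucasSeq (aeval l) c (algebraMap ℂ ℂ[X] ((q : ℂ) + 1) - X) (n + 1)
    rw [map_sub, AlgHom.commutes, aeval_X, Algebra.algebraMap_self, RingHom.id_apply,
      coe_aeval_eq_eval] at this
    rw [hP, eval_mul, eval_C]
    erw [this]
    ring
  have hPentry : ∀ n, entry (aeval (lapOp G) (P n)) x₀ x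
      = entry (lucasSeq c (adjOp G) (n + 1)) x₀ x / (n + 1 : ℂ) * u ^ (n + 1) := fun n => by
    rw [hP, map_mul, map_lucasSeq, map_sub, AlgHom.commutes, aeval_X, lapOp_regular hG, aeval_C,
      ← Algebra.smul_def, entry_smul]
    ring
  have hroots : ∀ l : spectrum ℝ (laplacian G h), ∃ a b : ℂ,
      a + b = (q : ℂ) + 1 - ((l : ℝ) : ℂ) ∧ a * b = c ∧
      ‖a‖ ≤ alpha G t ∧ ‖b‖ ≤ alpha G t := fun l => by
    refine exists_roots hG ?_ hc
    have h1 := abs_degree_sub_le_of_mem_spectrum G hG h l.2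
    rw [← Real.norm_eq_abs, ← Complex.norm_real] at h1
    simpa using h1
  have hlt : ∀ a : ℂ, ‖a‖ ≤ alpha G t → ‖a * u‖ < 1 := fun a ha => by
    rw [norm_mul]
    exact (mul_le_mul_of_nonneg_right ha (norm_nonneg _)).trans_lt hu
  have main := hasSum_integral_spectralMeasure (laplacian G h) (isSelfAdjoint_laplacian G h)
    (delta x₀) (delta x)
    (f := fun n (l : spectrum ℝ (laplacian G h)) => (P n).eval ((l : ℝ) : ℂ))
    (g := fun l => -Complex.log (1 - ((q : ℂ) + 1 - ((l : ℝ) : ℂ)) * u + c * u ^ 2))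
    -- Each power sum has two terms of modulus at most `alpha ^ (n + 1)`, uniformly on the spectrum.
    (b := fun n => 2 * (alpha G t * ‖u‖) ^ (n + 1))
    (fun n => by fun_prop) (fun n l => ?_) ?_ (fun l => ?_)
  · refine ⟨main.1, ?_⟩
    simp only [← hPentry, ← integral_polynomial_laplacianMeasure G h]
    exact main.2
  · obtain ⟨a, b, hab, hab', ha, hb⟩ := hroots l
    rw [hPeval, ← hab, ← hab', lucasSeq_eq_pow_add_pow, norm_mul, norm_div, norm_pow]
    have h3 : 1 ≤ ‖(n + 1 : ℂ)‖ := by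
      have : (n + 1 : ℂ) = ((n + 1 : ℕ) : ℂ) := by push_cast; rfl
      rw [this, Complex.norm_natCast]
      push_cast
      linarith [show (0 : ℝ) ≤ n by positivity]
    calc _ ≤ (alpha G t ^ (n + 1) + alpha G t ^ (n + 1)) * ‖u‖ ^ (n + 1) := by
          gcongr
          refine (div_le_self (norm_nonneg _) h3).trans ((norm_add_le _ _).trans ?_)
          rw [norm_pow, norm_pow]
          gcongr
      _ = _ := by rw [mul_pow]; ring
  · exact ((summable_nat_add_iff 1).2 (summable_geometric_of_lt_one (by positivity) hu)).mul_left 2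
  · obtain ⟨a, b, hab, hab', ha, hb⟩ := hroots l
    simp only [hPeval, ← hab, ← hab', lucasSeq_eq_pow_add_pow]
    exact hasSum_neg_log_quadratic (hlt a ha) (hlt b hb)

/-- Writes the parity indicator as a power sum of `±s`, so that `hasSum_neg_log_quadratic` also sums
the scalar part. -/
theorem pow_add_neg_pow (s : ℂ) (m : ℕ) :
    s ^ m + (-s) ^ m = 2 * ((if Even m then 1 else 0) * s ^ m) := by
  split_ifs with h
  · rw [h.neg_pow]; ring
  · rw [(Nat.not_even_iff_odd.1 h).neg_pow]; ring

/-- The decomposition of the coefficients of the logarithm of the zeta function. -/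
theorem entry_cbcOp_succ (hG : G.IsRegularOfDegree (q + 1)) {t : ℂ} (ht : 1 - t ≠ 0) (u : ℂ)
    (x₀ x : V) (m : ℕ) :
    entry (cbcOp G t (m + 1)) x₀ x / (m + 1 : ℂ) * u ^ (m + 1)
      = entry (lucasSeq ((1 - t) * (q + t)) (adjOp G) (m + 1)) x₀ x / (m + 1 : ℂ) * u ^ (m + 1)
        + (((q : ℂ) - 1) / 2 * entry 1 x₀ x) *
          (((1 - t) ^ (m + 1) + (-(1 - t)) ^ (m + 1)) / (m + 1 : ℂ) * u ^ (m + 1))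
        + (if m = 1 then
            entry (t • degOp G - pathOp G t 2) x₀ x / 2 * (1 - t) * u ^ 2 else 0)
        + (1 - t) * entry (Rop G t (m + 1)) x₀ x / (m + 1 : ℂ) * u ^ (m + 1) := by
  rw [pow_add_neg_pow]
  match m with
  | 0 =>
    rw [Rop_eq_zero t (by norm_num), cbcOp_one t ((1 - t) * (q + t))]
    have h0 : entry (0 : Module.End ℂ (V → ℂ)) x₀ x = 0 := rfl
    simp [h0]
  | 1 =>
    rw [Rop_eq_zero t (by norm_num)]
    have h0 : entry (0 : Module.End ℂ (V → ℂ)) x₀ x = 0 := rfl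
    rw [cbcOp_two hG, entry_add, entry_add, entry_smul, entry_smul, h0, if_pos (by decide),
      if_pos rfl]
    push_cast
    ring
  | m + 2 =>
    rw [cbcOp_add_three hG t ht, entry_add, entry_add, entry_smul, entry_smul,
      if_neg (show m + 2 ≠ 1 by omega)]
    ring

end Estimates
end Bartholdi

/-! ### The factorization of the zeta function -/

theorem corollary4p5 {V : Type*} (G : SimpleGraph V) [G.LocallyFinite] (q : ℕ)
    (hG : G.IsRegularOfDegree (q + 1)) (t u : ℂ) (ht : ‖t‖ < 1)
    (hu : ‖u‖ < 1 / Bartholdi.alpha G t) (x₀ x : V) :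
    -- the two series and the integral below converge absolutely
    Summable (fun m : ℕ =>
      Bartholdi.entry (Bartholdi.cbcOp G t (m + 1)) x₀ x / (m + 1 : ℂ) * u ^ (m + 1)) ∧
    Summable (fun m : ℕ =>
      (1 - t) * Bartholdi.entry (Bartholdi.Rop G t (m + 3)) x₀ x / (m + 3 : ℂ) * u ^ (m + 3)) ∧
    (Bartholdi.laplacianMeasure G (Bartholdi.boundedDegree_of_regular G hG) x₀ x).Integrable
      (fun l => -Complex.log (1 - ((q : ℂ) + 1 - ((l : ℝ) : ℂ)) * u + (1 - t) * (q + t) * u ^ 2)) ∧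
    Bartholdi.bartholdiZeta G u t x₀ x =
      (1 - (1 - t) ^ 2 * u ^ 2) ^
          (-(((q : ℂ) - 1) / 2) * (open Classical in if x = x₀ then 1 else 0)) *
        Complex.exp
          ((Bartholdi.laplacianMeasure G (Bartholdi.boundedDegree_of_regular G hG) x₀ x).integral
            (fun l => -Complex.log
              (1 - ((q : ℂ) + 1 - ((l : ℝ) : ℂ)) * u + (1 - t) * (q + t) * u ^ 2))
            (ContinuousLinearMap.mul ℝ ℂ)) *
        Complex.exp
          (Bartholdi.entry (t • Bartholdi.degOp G - Bartholdi.pathOp G t 2) x₀ x / 2 *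
            (1 - t) * u ^ 2) *
        Complex.exp (∑' m : ℕ,
          (1 - t) * Bartholdi.entry (Bartholdi.Rop G t (m + 3)) x₀ x / (m + 3 : ℂ) *
            u ^ (m + 3)) := by
  have : Nonempty V := ⟨x⟩
  have hK := Bartholdi.degree_le_alpha hG t
  have hK0 : 0 < Bartholdi.alpha G t := lt_of_lt_of_le (by positivity) hK
  have huK : Bartholdi.alpha G t * ‖u‖ < 1 := by
    rw [lt_div_iff₀ hK0] at hu
    rwa [mul_comm]
  have ht1 : 1 - t ≠ 0 := fun h => by
    rw [← sub_eq_zero.1 h, norm_one] at ht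
    exact lt_irrefl _ ht
  have hs : ‖1 - t‖ ≤ Bartholdi.alpha G t :=
    (norm_sub_le _ _).trans (by
      rw [norm_one, add_comm]; exact Bartholdi.norm_add_one_le_alpha hG ht)
  have hsu : ‖(1 - t) * u‖ < 1 := by
    rw [norm_mul]
    exact (mul_le_mul_of_nonneg_right hs (norm_nonneg _)).trans_lt huK
  have hR := Bartholdi.summable_Rop hG ht huK x₀ x
  obtain ⟨hint, hL⟩ := Bartholdi.hasSum_lucasSeq hG (Bartholdi.boundedDegree_of_regular G hG)
    ht huK x₀ x
  -- The roots `1 - t` and `-(1 - t)` have sum `0` and product `-(1-t)²`, which gives the first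
  -- factor.
  have hlog := (Bartholdi.hasSum_neg_log_quadratic hsu
    (show ‖-(1 - t) * u‖ < 1 by rwa [neg_mul, norm_neg])).mul_left
      (((q : ℂ) - 1) / 2 * Bartholdi.entry 1 x₀ x)
  -- Index `1` stands for `u²`, the only exponent that needs the correction by `t D - C_2`.
  have hone := hasSum_ite_eq (1 : ℕ)
    (Bartholdi.entry (t • Bartholdi.degOp G - Bartholdi.pathOp G t 2) x₀ x / 2 * (1 - t) * u ^ 2)
  have hR' : HasSum (fun m : ℕ => (1 - t) * Bartholdi.entry (Bartholdi.Rop G t (m + 1)) x₀ x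
      / (m + 1 : ℂ) * u ^ (m + 1)) (∑' m : ℕ, (1 - t) *
        Bartholdi.entry (Bartholdi.Rop G t (m + 3)) x₀ x / (m + 3 : ℂ) * u ^ (m + 3)) := by
    -- The sums defining `R_1` and `R_2` are empty, so the series may start at exponent one.
    refine (hasSum_nat_add_iff' 2).1 ?_
    have h0 : Bartholdi.entry (0 : Module.End ℂ (V → ℂ)) x₀ x = 0 := rfl
    have e : ∀ m : ℕ, ((m + 2 : ℕ) : ℂ) + 1 = m + 3 := fun m => by push_cast; ring
    simp only [Finset.sum_range_succ, Finset.sum_range_zero,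
      Bartholdi.Rop_eq_zero t (show 0 + 1 ≤ 2 by norm_num),
      Bartholdi.Rop_eq_zero t (show 1 + 1 ≤ 2 by norm_num), h0, mul_zero, zero_div,
      zero_mul, add_zero, sub_zero, e]
    exact hR.hasSum
  have htotal := ((hL.add hlog).add hone).add hR'
  simp only [← Bartholdi.entry_cbcOp_succ hG ht1 u x₀ x] at htotal
  refine ⟨htotal.summable, hR, hint, ?_⟩
  have hquad : 1 - (1 - t + -(1 - t)) * u + (1 - t) * -(1 - t) * u ^ 2
      = 1 - (1 - t) ^ 2 * u ^ 2 := by ring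
  -- A nonzero base is what makes the complex power equal to `exp (log · exponent)`.
  have hne : 1 - (1 - t) ^ 2 * u ^ 2 ≠ 0 := fun h => by
    have h1 : ((1 - t) * u) ^ 2 = 1 := by linear_combination -h
    have h2 : ‖(1 - t) * u‖ ^ 2 = 1 := by rw [← norm_pow, h1, norm_one]
    exact (pow_lt_one₀ (norm_nonneg _) hsu two_ne_zero).ne h2
  rw [Bartholdi.bartholdiZeta, htotal.tsum_eq, hquad, Complex.cpow_def_of_ne_zero hne,
    ← Complex.exp_add, ← Complex.exp_add, ← Complex.exp_add, Bartholdi.entry_one]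
  congr 1
  ring
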